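/- All graphs are finite, simple, undirected and have at least one vertex. For a graph $G$ and $A\subseteq V(G)$ write $\overline A=V(G)\setminus A$. The cut $(A,\overline A)$ is a \emph{split} if $|A|\ge 2$, $|\overline A|\ge 2$ and all vertices of $A$ that have a neighbour in $\overline A$ have the same neighbourhood in $\overline A$. Let $\operatorname{sm}(A)=1$ if $(A,\overline A)$ is a split, and otherwise let $\operatorname{sm}(A)$ be the maximum size of a matching in the bipartite graph of the edges of $G$ between $A$ and $\overline A$. Let $\operatorname{cutrk}(A)$ be the rank over $\mathbb{F}_2$ of the $A\times\overline A$ submatrix of the adjacency matrix of $G$. A \emph{branch decomposition} of $G$ is a tree $T$ of maximum degree at most $3$ with a bijection from the leaves of $T$ to $V(G)$ (the vertex of a one-vertex tree counts as a leaf); each edge $e$ of $T$ induces the cut of $G$ given by the leaves in the two components of $T-e$. For a symmetric function $f$ on subsets of $V(G)$, the $f$-width of a branch decomposition is the maximum of $f(A)$ over the cuts $(A,\overline A)$ induced by the edges of $T$ ($0$ if $T$ has no edge). The \emph{sm-width} of $G$ is the minimum $\operatorname{sm}$-width over all branch decompositions of $G$. The \emph{clique-width} of $G$ is the least number $k$ of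 labels with which $G$ can be built by: creating a vertex with a label, disjoint union, adding all edges between the vertices with label $i$ and those with label $j$ ($i\neq j$), and changing all labels $i$ to $j$. \emph{Cographs} are the graphs obtained from one-vertex graphs by disjoint union and complementation. A graph $G$ is \emph{distance-hereditary} if distances in every connected induced subgraph are equal to those in $G$. \textbf{Proposition.} Let $G$ be a graph. \begin{enumerate} \item $G$ is a cograph if and only if its clique-width is at most two. \item If $G$ is a cograph, then its sm-width is at most one, and it is equal to one if $G$ has an edge. \item If $G$ is distance-hereditary, then its clique-width is at most three, its sm-width is at most one, and its sm-width is equal to one if $G$ has an edge. Moreover, $G$ then has a branch decomposition of $\operatorname{cutrk}$-width at most one (equal to one if $G$ has an edge) such that every cut induced by an edge of its tree and having at least two vertices on both sides is a split. \end{enumerate} -/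

import Mathlib

universe u

/-- Cographs (complement-reducible graphs): the smallest class of graphs, closed under isomorphism,
that contains the one-vertex graph and is closed under disjoint union and complementation. -/
inductive IsCograph : {V : Type u} → SimpleGraph V → Prop
  | single {V : Type u} [Unique V] (G : SimpleGraph V) : IsCograph G
  | sum {V W : Type u} {G : SimpleGraph V} {H : SimpleGraph W} :
      IsCograph G → IsCograph H → IsCograph (G.sum H)
  | compl {V : Type u} {G : SimpleGraph V} : IsCograph G → IsCograph Gᶜ
  | iso {V W : Type u} {G : SimpleGraph V} {H : SimpleGraph W} :
      G ≃g H → IsCograph G → IsCograph H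

/-- Distance-hereditary graphs: distances in every connected induced subgraph agree with the
distances in the whole graph. -/
def IsDistanceHereditary {V : Type u} (G : SimpleGraph V) : Prop :=
  ∀ S : Set V, (G.induce S).Connected →
    ∀ a b : S, (G.induce S).dist a b = G.dist (a : V) (b : V)

/-! ### Clique-width -/

/-- Clique-width expressions with `k` labels: create a vertex with label `i`; take a disjoint union;
for `i ≠ j`, add all edges between the vertices labelled `i` and those labelled `j`;
change every label `i` to `j`. -/
inductive CliqueExpr (k : ℕ) : Type
  | vertex (i : Fin k) : CliqueExpr k
  | union (s t : CliqueExpr k) : CliqueExpr k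
  | join (i j : Fin k) (hij : i ≠ j) (t : CliqueExpr k) : CliqueExpr k
  | relabel (i j : Fin k) (t : CliqueExpr k) : CliqueExpr k

namespace CliqueExpr

/-- The vertices of the labelled graph described by an expression. -/
def Verts {k : ℕ} : CliqueExpr k → Type
  | vertex _ => Unit
  | union s t => s.Verts ⊕ t.Verts
  | join _ _ _ t => t.Verts
  | relabel _ _ t => t.Verts

/-- The labelling of the vertices. -/
def label {k : ℕ} : (t : CliqueExpr k) → t.Verts → Fin k
  | vertex i => fun _ => i
  | union s t => Sum.elim s.label t.label
  | join _ _ _ t => t.label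
  | relabel i j t => fun v => if t.label v = i then j else t.label v

/-- The graph described by an expression. -/
def graph {k : ℕ} : (t : CliqueExpr k) → SimpleGraph t.Verts
  | vertex _ => (⊥ : SimpleGraph Unit)
  | union s t => s.graph.sum t.graph
  | join i j _ t =>
      t.graph ⊔ SimpleGraph.fromRel (fun a b => t.label a = i ∧ t.label b = j)
  | relabel _ _ t => t.graph

end CliqueExpr

/-- The clique-width of a graph: the least number `k` of labels such that the graph is isomorphic to
the graph described by an expression with `k` labels (`⊤` if there is none, which never happens for
a finite graph with at least one vertex). -/
noncomputable def cliqueWidth {V : Type u} (G : SimpleGraph V) : ℕ∞ :=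
  ⨅ (k : ℕ) (_ : ∃ t : CliqueExpr k, Nonempty (G ≃g t.graph)), (k : ℕ∞)

/-! ### Branch decompositions -/

/-- The leaves of a tree: the vertices of degree at most one. In a tree with at least two vertices
these are the vertices of degree one; the vertex of a one-vertex tree counts as a leaf. -/
def treeLeaves {N : Type} (T : SimpleGraph N) : Set N :=
  {x | (T.neighborSet x).encard ≤ 1}

/-- A branch decomposition over the vertex set `V`: a finite tree of maximum degree at most three
with a bijection from its leaves to `V`. -/
structure BranchDecomposition (V : Type u) where
  Node : Type
  finite_node : Finite Node
  tree : SimpleGraph Node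
  isTree : tree.IsTree
  subcubic : ∀ x, (tree.neighborSet x).encard ≤ 3
  leafEquiv : treeLeaves tree ≃ V

namespace BranchDecomposition

/-- For an edge `xy` of the tree, the elements of `V` mapped from the leaves in the component of `x`
after deletion of `xy`; the cut induced by the edge is this set with its complement. -/
def side {V : Type u} (D : BranchDecomposition V) (x y : D.Node) : Set V :=
  {v | (D.tree.deleteEdges {s(x, y)}).Reachable x (D.leafEquiv.symm v : D.Node)}

/-- The `f`-width of a branch decomposition: the maximum of `f` over the cuts induced by the edges
of the tree (`0` if the tree has no edge). -/
noncomputable def width {V : Type u} (D : BranchDecomposition V) (f : Set V → ℕ∞) : ℕ∞ :=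
  ⨆ (x : D.Node) (y : D.Node) (_ : D.tree.Adj x y), f (D.side x y)

end BranchDecomposition

/-- The `f`-width of a graph on `V`, for a cut function `f`: the minimum `f`-width of a branch
decomposition. -/
noncomputable def cutFunctionWidth {V : Type u} (f : Set V → ℕ∞) : ℕ∞ :=
  ⨅ D : BranchDecomposition V, D.width f

/-! ### Splits and split-matching-width -/

/-- The cut `(A, Aᶜ)` is a split: both sides have at least two vertices, and all vertices of `A` with
a neighbour in `Aᶜ` have the same neighbourhood in `Aᶜ`. -/
def IsSplit {V : Type u} (G : SimpleGraph V) (A : Set V) : Prop :=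
  2 ≤ A.encard ∧ 2 ≤ Aᶜ.encard ∧
    ∀ a ∈ A, ∀ b ∈ A, (G.neighborSet a ∩ Aᶜ).Nonempty → (G.neighborSet b ∩ Aᶜ).Nonempty →
      G.neighborSet a ∩ Aᶜ = G.neighborSet b ∩ Aᶜ

/-- `mm(A)`: the maximum cardinality of a matching of the bipartite graph `G[A, Aᶜ]`. -/
noncomputable def matchingCut {V : Type u} (G : SimpleGraph V) (A : Set V) : ℕ∞ :=
  ⨆ (M : (G.between A Aᶜ).Subgraph) (_ : M.IsMatching), M.edgeSet.encard

open Classical in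
/-- `sm(A)`: `1` if the cut `(A, Aᶜ)` is a split, and `mm(A)` otherwise. -/
noncomputable def splitMatchingCut {V : Type u} (G : SimpleGraph V) (A : Set V) : ℕ∞ :=
  if IsSplit G A then 1 else matchingCut G A

/-- The split-matching-width (sm-width) of a graph. -/
noncomputable def smWidth {V : Type u} (G : SimpleGraph V) : ℕ∞ :=
  cutFunctionWidth (splitMatchingCut G)

open Classical in
/-- The cut-rank of `A`: the rank over the two-element field of the `A × Aᶜ` submatrix of the
adjacency matrix. -/
noncomputable def cutRank {V : Type u} (G : SimpleGraph V) (A : Set V) : ℕ∞ :=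
  ((G.adjMatrix (ZMod 2)).submatrix (Subtype.val : A → V) (Subtype.val : (Aᶜ : Set V) → V)).eRank

/-! Both graph classes are governed by a binary merging scheme of the vertex set (`Hierarchy`). For
cographs every merged set is a module (`IsCograph.hierarchy`); for distance-hereditary graphs every
merged set has a cut whose edges form a complete bipartite graph (`IsDistanceHereditary.hierarchy`).
Modules have such cuts, so the width bounds need only the second kind of scheme.

The scheme yields both sorts of width. Read bottom-up it is a clique-width expression: two labels
suffice for modules, since a merge adds all or no cross edges; three suffice for simple cuts, to
tell inactive vertices from the active vertices of the two sets being merged. Read as a tree it is a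
branch decomposition whose cuts are all simple, hence of cut-rank and sm-value at most one. An edge
of `G` forces value at least one at the cut of the tree edge at a leaf. Conversely, expressions with
at most two labels only build cographs (`CliqueExpr.isCograph`), because a join there is between
complementary label classes.

The hard part is the scheme for distance-hereditary graphs. It comes from
`IsDistanceHereditary.exists_split`: in the last level of a breadth-first search, either a class of
vertices with equal neighbours one level up, or the neighbourhood of a vertex with fewest such
neighbours, or a pair at a pendant vertex, gives a split. Replacing either side of a split by one
representative vertex leaves an induced subgraph, so induction applies to both parts, and simple
cuts of the parts lift to the whole graph. -/

/-- The cut of `U` into `A` and `U \ A` has rank at most one: all vertices of `A` that have a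
neighbour in `U \ A` have the same neighbourhood in `U \ A`. -/
def SimpleCut {V : Type u} (G : SimpleGraph V) (U A : Set V) : Prop :=
  ∀ ⦃a b c d : V⦄, a ∈ A → b ∈ A → c ∈ U \ A → d ∈ U \ A → G.Adj a c → G.Adj b d → G.Adj a d

/-! ### Distances in distance-hereditary graphs -/

namespace IsDistanceHereditary

variable {V : Type u} {G : SimpleGraph V}

theorem exists_adj_dist (hG : IsDistanceHereditary G) {S : Set V} (hS : (G.induce S).Connected)
    {r y : V} (hr : r ∈ S) (hy : y ∈ S) (hne : r ≠ y) :
    ∃ q ∈ S, G.Adj q y ∧ G.dist r q + 1 = G.dist r y := by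
  obtain ⟨p, hp⟩ := hS.exists_walk_length_eq_dist ⟨y, hy⟩ ⟨r, hr⟩
  have hd := hG S hS
  cases p with
  | nil => exact absurd rfl hne
  | @cons _ q _ h p =>
    refine ⟨q, q.2, (by simpa using h.symm), ?_⟩
    have h1 := SimpleGraph.dist_le p
    have h2 : (G.induce S).dist ⟨y, hy⟩ q = 1 := SimpleGraph.dist_eq_one_iff_adj.2 h
    have h3 := hS.dist_triangle (u := ⟨y, hy⟩) (v := q) (w := ⟨r, hr⟩)
    simp only [SimpleGraph.Walk.length_cons] at hp
    rw [hd] at h1 hp h2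
    rw [hd, hd, hd] at h3
    simp only at h1 h2 h3 hp
    rw [G.dist_comm, G.dist_comm (u := r)]
    omega

/-- Distance-heredity passes to induced subgraphs. -/
theorem induce (hG : IsDistanceHereditary G) (U : Set V) : IsDistanceHereditary (G.induce U) := by
  intro S hS a b
  let e : (G.induce U).induce S ≃g G.induce (Subtype.val '' S) :=
    { toEquiv := Equiv.Set.image _ S Subtype.val_injective
      map_rel_iff' := Iff.rfl }
  have hS' := (e.connected_iff).1 hS
  -- The distance in `G.induce U` is squeezed between the distance in `G` and the one inside `S`,
  -- which agree because the image of `S` is connected in `G`.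
  apply le_antisymm
  · obtain ⟨p, hp⟩ := hS'.exists_walk_length_eq_dist (e a) (e b)
    have h1 := hG _ hS' (e a) (e b)
    have h2 : ((G.induce U).induce S).dist a b ≤ p.length := by
      have := SimpleGraph.dist_le (p.map e.symm.toHom)
      rw [SimpleGraph.Walk.length_map] at this
      have ha : e.symm.toHom (e a) = a := e.symm_apply_apply a
      have hb : e.symm.toHom (e b) = b := e.symm_apply_apply b
      rwa [ha, hb] at this
    obtain ⟨q, hq⟩ :=
      (SimpleGraph.Reachable.map (SimpleGraph.Embedding.induce S).toHom
        (hS a b)).exists_walk_length_eq_dist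
    have h3 := SimpleGraph.dist_le (q.map (SimpleGraph.Embedding.induce U).toHom)
    have h4 : q.length = (G.induce U).dist a b := hq
    rw [SimpleGraph.Walk.length_map] at h3
    have h5 : G.dist (e a : V) (e b) ≤ q.length := h3
    omega
  · obtain ⟨q, hq⟩ := hS.exists_walk_length_eq_dist a b
    have h3 := SimpleGraph.dist_le (q.map (SimpleGraph.Embedding.induce S).toHom)
    rw [SimpleGraph.Walk.length_map] at h3
    rw [← hq]
    exact h3

end IsDistanceHereditary

namespace SimpleGraph

variable {V : Type u} {G : SimpleGraph V}

theorem connected_induce_insert {S : Set V} (hS : (G.induce S).Connected) {v w : V}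
    (hw : w ∈ S) (h : G.Adj w v) : (G.induce (insert v S)).Connected := by
  rw [Set.insert_eq, Set.union_comm]
  refine connected_induce_union hS.preconnected ?_ hw (Set.mem_singleton v) h
  rintro ⟨a, rfl⟩ ⟨b, rfl⟩
  exact Reachable.refl _

/-- A connected set containing `r` and `v` in which `v` is the only vertex that is at least as far
from `r` as `v`. -/
theorem Reachable.exists_geodesic_set {r v : V} (h : G.Reachable r v) :
    ∃ S : Set V, (G.induce S).Connected ∧ r ∈ S ∧ v ∈ S ∧
      ∀ t ∈ S, G.dist r v ≤ G.dist r t → t = v := by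
  classical
  obtain ⟨p, hp⟩ := h.exists_walk_length_eq_dist
  refine ⟨_, p.connected_induce_support, p.start_mem_support, p.end_mem_support, ?_⟩
  intro t ht hd
  have h1 := dist_le (p.takeUntil t ht)
  have h2 := congrArg Walk.length (p.take_spec ht)
  rw [Walk.length_append] at h2
  exact Walk.eq_of_length_eq_zero (p := p.dropUntil t ht) (by omega)

end SimpleGraph

namespace IsDistanceHereditary

variable {V : Type u} {G : SimpleGraph V}

/-- Adjacent vertices at the same distance from `r` have the same neighbours one level closer
to `r`. -/
theorem adj_of_adj_of_dist_eq (hG : IsDistanceHereditary G) {r x y p : V}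
    (hr : G.Reachable r p) (hxy : G.Adj x y) (hxp : G.Adj x p)
    (hx : G.dist r x = G.dist r p + 1) (hy : G.dist r y = G.dist r p + 1) : G.Adj y p := by
  obtain ⟨S, hS, hrS, hpS, hSp⟩ := hr.exists_geodesic_set
  have h1 := SimpleGraph.connected_induce_insert hS hpS hxp.symm
  have h2 := SimpleGraph.connected_induce_insert h1 (Set.mem_insert x S) hxy
  have hne : r ≠ y := by rintro rfl; simp at hy
  -- A predecessor of `y` inside this connected set lies on the level of `p`: that excludes `x` and
  -- `y`, and on the geodesic only `p` is that far from `r`.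
  obtain ⟨q, hq, hqy, hd⟩ := hG.exists_adj_dist h2 (r := r) (y := y) (by simp [hrS]) (by simp) hne
  rcases hq with rfl | rfl | hq
  · omega
  · omega
  · obtain rfl := hSp q hq (by omega)
    exact hqy.symm

/-- Two vertices with a common neighbour one level further from `r` have the same neighbours one
level closer to `r`. -/
theorem adj_of_common_adj (hG : IsDistanceHereditary G) {r x p q d : V}
    (hr : G.Reachable r d) (hxp : G.Adj x p) (hxq : G.Adj x q) (hqd : G.Adj q d)
    (hp : G.dist r p = G.dist r d + 1) (hq : G.dist r q = G.dist r d + 1)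
    (hx : G.dist r x = G.dist r d + 2) : G.Adj p d := by
  obtain ⟨S, hS, hrS, hdS, hSd⟩ := hr.exists_geodesic_set
  have h1 := SimpleGraph.connected_induce_insert hS hdS hqd.symm
  have h2 := SimpleGraph.connected_induce_insert h1 (Set.mem_insert q S) hxq.symm
  have h3 := SimpleGraph.connected_induce_insert h2 (Set.mem_insert x _) hxp
  have hne : r ≠ p := by rintro rfl; simp at hp
  obtain ⟨t, ht, htp, hd⟩ := hG.exists_adj_dist h3 (r := r) (y := p) (by simp [hrS]) (by simp) hne
  rcases ht with rfl | rfl | rfl | ht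
  · omega
  · omega
  · omega
  · obtain rfl := hSd t ht (by omega)
    exact htp.symm

/-- In a connected induced subgraph, two vertices with a common neighbour in `G` are equal, adjacent
or have a common neighbour. -/
theorem exists_common_adj (hG : IsDistanceHereditary G) {S : Set V} (hS : (G.induce S).Connected)
    {x y q : V} (hx : x ∈ S) (hy : y ∈ S) (hne : x ≠ y) (hxy : ¬ G.Adj x y)
    (hxq : G.Adj x q) (hqy : G.Adj q y) : ∃ t ∈ S, G.Adj x t ∧ G.Adj t y := by
  obtain ⟨t, ht, hty, hd⟩ := hG.exists_adj_dist hS hx hy hne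
  have h2 : G.dist x y ≤ 2 := SimpleGraph.dist_le (.cons hxq (.cons hqy .nil))
  refine ⟨t, ht, ?_, hty⟩
  have htx : t ≠ x := by rintro rfl; exact hxy hty
  have h3 : G.dist x t ≠ 0 := by
    rw [SimpleGraph.dist_ne_zero_iff_ne_and_reachable]
    exact ⟨htx.symm, (hxq.reachable.trans hqy.reachable).trans hty.reachable.symm⟩
  exact SimpleGraph.dist_eq_one_iff_adj.1 (by omega)

end IsDistanceHereditary

/-! ### Existence of splits -/

namespace SimpleGraph

variable {V : Type u} {G : SimpleGraph V}

theorem pair_compl_nontrivial (h4 : 4 ≤ Nat.card V) (u w : V) : ({u, w} : Set V)ᶜ.Nontrivial := by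
  have : Finite V := Nat.finite_of_card_ne_zero (by omega)
  rw [← Set.one_lt_ncard_iff_nontrivial]
  have h1 := Set.ncard_add_ncard_compl ({u, w} : Set V)
  have h2 : ({u, w} : Set V).ncard ≤ 2 := by
    simpa using Set.ncard_insert_le u {w}
  omega

/-- The side `{u, w}` works because only `w` can have neighbours outside it. An isolated `u` is
allowed, with any other vertex as `w`. -/
theorem exists_split_of_pendant (h4 : 4 ≤ Nat.card V) {u w : V} (hne : u ≠ w)
    (h : ∀ t, G.Adj u t → t = w) :
    ∃ A : Set V, A.Nontrivial ∧ Aᶜ.Nontrivial ∧ SimpleCut G Set.univ A := by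
  refine ⟨{u, w}, Set.nontrivial_pair hne, pair_compl_nontrivial h4 u w, ?_⟩
  have key : ∀ a c, a ∈ ({u, w} : Set V) → c ∉ ({u, w} : Set V) → G.Adj a c → a = w := by
    rintro a c (rfl | rfl) hc hac
    · exact absurd (Or.inr (h c hac)) hc
    · rfl
  intro a b c d ha hb hc hd hac hbd
  rw [key a c ha hc.2 hac, ← key b d hb hd.2 hbd]
  exact hbd

/-- The component of `u` has no edges leaving it; it may only be too small, or its complement may
be, when `u` or `v` is isolated, and this is the pendant case. -/
theorem exists_split_of_not_preconnected (h4 : 4 ≤ Nat.card V) (h : ¬ G.Preconnected) :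
    ∃ A : Set V, A.Nontrivial ∧ Aᶜ.Nontrivial ∧ SimpleCut G Set.univ A := by
  simp only [Preconnected, not_forall] at h
  obtain ⟨u, v, huv⟩ := h
  have hne : u ≠ v := by rintro rfl; exact huv (Reachable.refl _)
  by_cases hu : ∃ t, G.Adj u t
  · by_cases hv : ∃ t, G.Adj v t
    · obtain ⟨s, hs⟩ := hu
      obtain ⟨t, ht⟩ := hv
      refine ⟨{t | G.Reachable u t}, ⟨u, Reachable.refl _, s, hs.reachable, hs.ne⟩,
        ⟨v, huv, t, fun h' => huv (Reachable.trans h' ht.reachable.symm), ht.ne⟩, ?_⟩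
      intro a b c d ha hb hc hd hac hbd
      exact absurd (Reachable.trans ha hac.reachable) hc.2
    · exact exists_split_of_pendant h4 hne.symm fun t ht => absurd ⟨t, ht⟩ hv
  · exact exists_split_of_pendant h4 hne fun t ht => absurd ⟨t, ht⟩ hu

end SimpleGraph

namespace IsDistanceHereditary

variable {V : Type u} {G : SimpleGraph V}

/-- In the last level of a breadth-first search, a vertex with the fewest neighbours and all of them
in the level before has a homogeneous neighbourhood. -/
theorem neighborSet_module (hG : IsDistanceHereditary G) (hc : G.Connected) [Finite V]
    {r x p q d : V} (hr : 2 ≤ G.dist r x) (hmax : ∀ t, G.dist r t ≤ G.dist r x)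
    (hmin : ∀ y, G.dist r y = G.dist r x → (G.neighborSet x).ncard ≤
      {t | G.Adj y t ∧ G.dist r t + 1 = G.dist r x}.ncard)
    (hx : ∀ t, G.Adj x t → G.dist r t + 1 = G.dist r x)
    (hxp : G.Adj x p) (hxq : G.Adj x q) (hxd : ¬ G.Adj x d) (hdx : d ≠ x) (hqd : G.Adj q d) :
    G.Adj p d := by
  by_contra hpd
  have hp := hx p hxp
  have hq := hx q hxq
  have hrp : r ≠ p := by rintro rfl; simp at hp; omega
  obtain ⟨e, -, hep, he⟩ := hG.exists_adj_dist (S := Set.univ)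
    ((SimpleGraph.induceUnivIso G).connected_iff.2 hc) (Set.mem_univ r) (Set.mem_univ p) hrp
  have hxe : ¬ G.Adj x e := fun h => by have := hx e h; omega
  have hxe' : x ≠ e := by rintro rfl; omega
  have common : ∀ {y s t}, G.dist r y = G.dist r x → G.Adj y s → G.Adj y t →
      G.dist r s + 1 = G.dist r x → G.dist r t + 1 = G.dist r x → G.Adj s e → G.Adj t e :=
    fun hy hys hyt hs ht hse =>
      hG.adj_of_common_adj (hc r e) hyt hys hse (by omega) (by omega) (by omega)
  have hqe : G.Adj q e := common rfl hxp hxq hp hq hep.symm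
  have hpe : G.Adj p e := hep.symm
  have hS : (G.induce {x, p, e}).Connected := by
    have h1 := SimpleGraph.induce_pair_connected_of_adj hpe
    exact SimpleGraph.connected_induce_insert h1 (by simp) hxp.symm
  -- If `d` is not closer to `r` than `q`, a connected set containing `x` and `d` is built in which
  -- only `p` can be a common neighbour of them; one must exist, as `q` is one in `G`.
  rcases hqd.diff_dist_adj (u := r) with hd | hd | hd
  · have hde : G.Adj d e := hG.adj_of_adj_of_dist_eq (hc r e) hqd hqe (by omega) (by omega)
    have hS' := SimpleGraph.connected_induce_insert hS (w := e) (by simp) hde.symm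
    obtain ⟨t, ht, hxt, htd⟩ := hG.exists_common_adj hS' (x := x) (y := d) (by simp) (by simp)
      hdx.symm hxd hxq hqd
    rcases ht with rfl | rfl | rfl | rfl
    · exact htd.ne rfl
    · exact hxt.ne rfl
    · exact hpd htd
    · exact hxe hxt
  -- Here `d` is in the last level. If all its neighbours one level up were neighbours of `x`, it
  -- would have fewer of them than `x`, as `p` is missing. So some `s` connects `d` to `e` while
  -- avoiding the neighbours of `x`.
  · have hsub : ∃ s, (G.Adj d s ∧ G.dist r s + 1 = G.dist r x) ∧ ¬ G.Adj x s := by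
      by_contra! hcon
      have hlt : {t | G.Adj d t ∧ G.dist r t + 1 = G.dist r x}.ncard <
          (G.neighborSet x).ncard := by
        apply Set.ncard_lt_ncard ⟨fun t ht => hcon t ht, fun h => ?_⟩
        exact hpd (h hxp).1.symm
      have := hmin d (by omega)
      omega
    obtain ⟨s, ⟨hds, hs⟩, hxs⟩ := hsub
    have hse : G.Adj s e := common (y := d) (by omega) hqd.symm hds hq hs hqe
    have hS' := SimpleGraph.connected_induce_insert hS (w := e) (by simp) hse.symm
    have hS'' := SimpleGraph.connected_induce_insert hS' (w := s) (by simp) hds.symm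
    obtain ⟨t, ht, hxt, htd⟩ := hG.exists_common_adj hS'' (x := x) (y := d) (by simp) (by simp)
      hdx.symm hxd hxq hqd
    rcases ht with rfl | rfl | rfl | rfl | rfl
    · exact htd.ne rfl
    · exact hxs hxt
    · exact hxt.ne rfl
    · exact hpd htd
    · exact hxe hxt
  · exact hpd (hG.adj_of_common_adj (hc r d) hxp hxq hqd (by omega) (by omega) (by omega))

/-- A distance-hereditary graph with at least four vertices has a split. -/
theorem exists_split (hG : IsDistanceHereditary G) (h4 : 4 ≤ Nat.card V) :
    ∃ A : Set V, A.Nontrivial ∧ Aᶜ.Nontrivial ∧ SimpleCut G Set.univ A := by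
  have : Finite V := Nat.finite_of_card_ne_zero (by omega)
  by_cases hpre : G.Preconnected
  swap
  · exact SimpleGraph.exists_split_of_not_preconnected h4 hpre
  have : Nonempty V := (Nat.card_pos_iff.1 (by omega)).1
  have hc : G.Connected := ⟨hpre⟩
  by_cases hcomp : ∀ s t, s ≠ t → G.Adj s t
  · have : Nontrivial V := Finite.one_lt_card_iff_nontrivial.1 (by omega)
    obtain ⟨u, w, huw⟩ := exists_pair_ne V
    refine ⟨{u, w}, Set.nontrivial_pair huw, SimpleGraph.pair_compl_nontrivial h4 u w, ?_⟩
    intro a b c d ha hb hc hd hac hbd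
    exact hcomp a d fun h => hd.2 (h ▸ ha)
  push Not at hcomp
  obtain ⟨r, t₀, hrt, hnadj⟩ := hcomp
  have ht₀ := hc.one_lt_dist_of_ne_of_not_adj hrt hnadj
  obtain ⟨x₀, hx₀⟩ := Finite.exists_max (G.dist r)
  -- Minimality is needed only when the neighbourhood of `x` is used as a side.
  obtain ⟨x, hx, hmin⟩ := Set.exists_min_image {y | G.dist r y = G.dist r x₀}
    (fun y => {t | G.Adj y t ∧ G.dist r t + 1 = G.dist r x₀}.ncard) (Set.toFinite _) ⟨x₀, rfl⟩
  rw [Set.mem_ofPred_eq] at hx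
  simp only [← hx, Set.mem_ofPred_eq] at hx₀ hmin
  have hk : 2 ≤ G.dist r x := ht₀.trans_le (hx₀ t₀)
  have hrx : r ≠ x := by rintro rfl; simp at hk
  by_cases hA : {y | G.dist r y = G.dist r x ∧
      ∀ t, G.dist r t + 1 = G.dist r x → (G.Adj y t ↔ G.Adj x t)}.Nontrivial
  · refine ⟨_, hA, ?_, ?_⟩
    · obtain ⟨s, hs⟩ := hc.exists_walk_length_eq_dist r x
      cases s with
      | nil => simp at hk
      | @cons _ s _ h p =>
        -- The complement contains vertices at distances 0 and 1 from `r`, while the last level is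
        -- at distance at least 2.
        refine ⟨r, fun h' => ?_, s, fun h' => ?_, h.ne⟩
        · have := h'.1
          simp only [SimpleGraph.dist_self] at this
          omega
        · have h1 := h'.1
          rw [SimpleGraph.dist_eq_one_iff_adj.2 h] at h1
          omega
    · have level : ∀ {y t}, G.dist r y = G.dist r x →
          (∀ t, G.dist r t + 1 = G.dist r x → (G.Adj y t ↔ G.Adj x t)) →
          t ∈ Set.univ \ {y | G.dist r y = G.dist r x ∧
            ∀ t, G.dist r t + 1 = G.dist r x → (G.Adj y t ↔ G.Adj x t)} →
          G.Adj y t → G.dist r t + 1 = G.dist r x := by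
        intro y t hy hyx ht hyt
        rcases hyt.diff_dist_adj (u := r) with hd | hd | hd
        · refine absurd ⟨hd.trans hy, fun s hs => ?_⟩ ht.2
          rw [← hyx s hs]
          exact ⟨fun h => hG.adj_of_adj_of_dist_eq (hc r s) hyt.symm h (by omega) (by omega),
            fun h => hG.adj_of_adj_of_dist_eq (hc r s) hyt h (by omega) (by omega)⟩
        · have := hx₀ t
          omega
        · have := hx₀ t
          omega
      intro a b c d ha hb hc hd hac hbd
      have hd' := level hb.1 hb.2 hd hbd
      exact (ha.2 d hd').2 ((hb.2 d hd').1 hbd)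
  -- A neighbour of `x` in the last level would have the same neighbours one level up, hence belong
  -- to the class of `x`, which is now trivial.
  · have hx1 : ∀ t, G.Adj x t → G.dist r t + 1 = G.dist r x := by
      intro t hxt
      rcases hxt.diff_dist_adj (u := r) with hd | hd | hd
      · refine absurd ⟨x, ⟨rfl, fun _ _ => Iff.rfl⟩, t, ⟨hd, fun s hs => ?_⟩, hxt.ne⟩ hA
        exact ⟨fun h => hG.adj_of_adj_of_dist_eq (hc r s) hxt.symm h (by omega) (by omega),
            fun h => hG.adj_of_adj_of_dist_eq (hc r s) hxt h (by omega) (by omega)⟩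
      · have := hx₀ t
        omega
      · have := hx₀ t
        omega
    by_cases hM : (G.neighborSet x).Nontrivial
    · refine ⟨_, hM, ⟨r, fun h => ?_, x, fun h => G.loopless.irrefl x h, hrx⟩, ?_⟩
      · have := hx1 r h
        simp only [SimpleGraph.dist_self] at this
        omega
      · intro a b c d ha hb hc' hd hac hbd
        by_cases hdx : d = x
        · subst hdx
          exact G.adj_symm ha
        · refine hG.neighborSet_module hc hk hx₀ (fun y hy => ?_) hx1 ha hb hd.2 hdx hbd
          have hN : G.neighborSet x = {t | G.Adj x t ∧ G.dist r t + 1 = G.dist r x} :=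
            Set.ext fun t => ⟨fun h => ⟨h, hx1 t h⟩, fun h => h.1⟩
          rw [hN]
          exact hmin y hy
    · rw [Set.not_nontrivial_iff] at hM
      by_cases hN : ∃ t, G.Adj x t
      · obtain ⟨t, ht⟩ := hN
        exact SimpleGraph.exists_split_of_pendant h4 ht.ne fun s hs => hM hs ht
      · exact SimpleGraph.exists_split_of_pendant h4 hrx.symm fun s hs => absurd ⟨s, hs⟩ hN

end IsDistanceHereditary

/-! ### Hierarchies of vertex sets -/

/-- A binary hierarchy on a set: starting from singletons, disjoint sets are merged until the whole
set is reached, and all sets arising by a merge have the property `P`. -/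
inductive Hierarchy {V : Type u} (P : Set V → Prop) : Set V → Prop
  | single (v : V) : Hierarchy P {v}
  | union {A B : Set V} : Hierarchy P A → Hierarchy P B → Disjoint A B → P (A ∪ B) →
      Hierarchy P (A ∪ B)

namespace Hierarchy

variable {V : Type u} {P Q : Set V → Prop} {A S : Set V}

theorem nonempty (h : Hierarchy P S) : S.Nonempty := by
  induction h with
  | single v => exact Set.singleton_nonempty v
  | union _ _ _ _ ih _ => exact ih.inl

theorem mono (h : Hierarchy P S) (hPQ : ∀ T ⊆ S, P T → Q T) : Hierarchy Q S := by
  induction h with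
  | single v => exact single v
  | union _ _ hd hP ih₁ ih₂ =>
    exact union (ih₁ fun T hT => hPQ T (hT.trans Set.subset_union_left))
      (ih₂ fun T hT => hPQ T (hT.trans Set.subset_union_right)) hd (hPQ _ subset_rfl hP)

theorem map {W : Type u} {R : Set W → Prop} (h : Hierarchy P S) {f : V → W}
    (hf : Function.Injective f) (hPR : ∀ T, P T → R (f '' T)) : Hierarchy R (f '' S) := by
  induction h with
  | single v =>
    rw [Set.image_singleton]
    exact single (f v)
  | union _ _ hd hP ih₁ ih₂ =>
    have := hPR _ hP
    rw [Set.image_union] at this ⊢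
    exact union ih₁ ih₂ ((Set.disjoint_image_iff hf).2 hd) this

/-- Replace the element `a` of a hierarchy by a hierarchy on `A`. -/
theorem subst {a : V} (h : Hierarchy P S) (hA : Hierarchy Q A) (ha : a ∈ S)
    (hd : Disjoint (S \ {a}) A) (h₁ : ∀ T ⊆ S, a ∉ T → P T → Q T)
    (h₂ : ∀ T ⊆ S, a ∈ T → P T → Q (T \ {a} ∪ A)) : Hierarchy Q (S \ {a} ∪ A) := by
  induction h with
  | single v =>
    obtain rfl : a = v := ha
    simpa using hA
  | @union B C hB hC hBC hP ihB ihC =>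
    have key := h₂ _ subset_rfl ha hP
    by_cases haB : a ∈ B
    · have haC : a ∉ C := hBC.notMem_of_mem_left haB
      have e : (B ∪ C) \ {a} ∪ A = (B \ {a} ∪ A) ∪ C := by
        rw [Set.union_sdiff_distrib, Set.sdiff_singleton_eq_self haC, Set.union_right_comm]
      have hCA : Disjoint C A := hd.mono_left fun x (hx : x ∈ C) =>
        Set.mem_sdiff_of_mem (Or.inr hx) fun h => haC (by rwa [← Set.mem_singleton_iff.1 h])
      rw [e] at key ⊢
      refine union (ihB haB (hd.mono_left (Set.sdiff_subset_sdiff_left Set.subset_union_left))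
        (fun T hT => h₁ T (hT.trans Set.subset_union_left))
        (fun T hT => h₂ T (hT.trans Set.subset_union_left)))
        (hC.mono fun T hT => h₁ T (hT.trans Set.subset_union_right) fun h => haC (hT h))
        (Set.disjoint_union_left.2 ⟨hBC.mono_left Set.sdiff_subset, hCA.symm⟩) key
    · have haC : a ∈ C := ha.resolve_left haB
      have e : (B ∪ C) \ {a} ∪ A = B ∪ (C \ {a} ∪ A) := by
        rw [Set.union_sdiff_distrib, Set.sdiff_singleton_eq_self haB, Set.union_assoc]
      have hBA : Disjoint B A := hd.mono_left fun x (hx : x ∈ B) =>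
        Set.mem_sdiff_of_mem (Or.inl hx) fun h => haB (by rwa [← Set.mem_singleton_iff.1 h])
      rw [e] at key ⊢
      refine union (hB.mono fun T hT => h₁ T (hT.trans Set.subset_union_left) fun h => haB (hT h))
        (ihC haC (hd.mono_left (Set.sdiff_subset_sdiff_left Set.subset_union_right))
        (fun T hT => h₁ T (hT.trans Set.subset_union_right))
        (fun T hT => h₂ T (hT.trans Set.subset_union_right)))
        (Set.disjoint_union_right.2 ⟨hBC.mono_right Set.sdiff_subset, hBA⟩) key

end Hierarchy

/-! ### Lifting simple cuts through a split -/

namespace SimpleCut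

variable {V : Type u} {G : SimpleGraph V} {U A C : Set V} {a : V}

theorem sdiff (h : SimpleCut G U A) (hA : A ⊆ U) : SimpleCut G U (U \ A) := by
  intro p q r s hp hq hr hs hpr hqs
  rw [Set.sdiff_sdiff_cancel_left hA] at hr hs
  exact (h hs hr hq hp hqs.symm hpr.symm).symm

theorem compl (h : SimpleCut G Set.univ A) : SimpleCut G Set.univ Aᶜ := by
  rw [Set.compl_eq_univ_sdiff]
  exact h.sdiff (Set.subset_univ A)

/-- A representative of one side of a cut: it has a neighbour on the other side if some vertex has. -/
theorem exists_representative (hA : A.Nonempty) (h : SimpleCut G U A) :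
    ∃ a ∈ A, ∀ u ∈ A, ∀ w ∈ U \ A, G.Adj u w → G.Adj a w := by
  by_cases hex : ∃ a ∈ A, ∃ w ∈ U \ A, G.Adj a w
  · obtain ⟨a, ha, w, hw, haw⟩ := hex
    exact ⟨a, ha, fun u hu w' hw' huw => h ha hu hw hw' haw huw⟩
  · obtain ⟨a, ha⟩ := hA
    exact ⟨a, ha, fun u hu w hw huw => absurd ⟨u, hu, w, hw, huw⟩ hex⟩

/-- A simple cut of the graph in which the side `A` is replaced by its representative `a` lifts. -/
theorem of_insert (hA : SimpleCut G U A) (ha : a ∈ A)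
    (hrep : ∀ u ∈ A, ∀ w ∈ U \ A, G.Adj u w → G.Adj a w) (hC : C ⊆ U \ A)
    (h : SimpleCut G (insert a (U \ A)) C) : SimpleCut G U C := by
  have haC : a ∉ C := fun h' => (hC h').2 ha
  intro p q r s hp hq hr hs hpr hqs
  have hr' : ∃ r' ∈ insert a (U \ A) \ C, G.Adj p r' := by
    by_cases hrA : r ∈ A
    · exact ⟨a, ⟨Or.inl rfl, haC⟩, (hrep r hrA p (hC hp) hpr.symm).symm⟩
    · exact ⟨r, ⟨Or.inr ⟨hr.1, hrA⟩, hr.2⟩, hpr⟩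
  obtain ⟨r', hr', hpr'⟩ := hr'
  by_cases hsA : s ∈ A
  · have hqa := (hrep s hsA q (hC hq) hqs.symm).symm
    have hpa := h hp hq hr' ⟨Or.inl rfl, haC⟩ hpr' hqa
    exact (hA hsA ha (hC hq) (hC hp) hqs.symm hpa.symm).symm
  · exact h hp hq hr' ⟨Or.inr ⟨hs.1, hsA⟩, hs.2⟩ hpr' hqs

/-- Expanding the marker `a` into `A` creates no new neighbourhoods: each vertex of `A` with a
neighbour in `U \ A` has the same neighbours there as `a`. -/
theorem of_insert_mem (hA : SimpleCut G U A) (haA : a ∈ A)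
    (hrep : ∀ u ∈ A, ∀ w ∈ U \ A, G.Adj u w → G.Adj a w) (hC : C ⊆ insert a (U \ A)) (ha : a ∈ C)
    (h : SimpleCut G (insert a (U \ A)) C) : SimpleCut G U (C \ {a} ∪ A) := by
  have out : ∀ x ∈ U \ (C \ {a} ∪ A), x ∈ U \ A ∧ x ∈ insert a (U \ A) \ C := by
    intro x hx
    have hxA : x ∉ A := fun h' => hx.2 (Or.inr h')
    refine ⟨⟨hx.1, hxA⟩, Or.inr ⟨hx.1, hxA⟩, fun h' => hx.2 (Or.inl ⟨h', ?_⟩)⟩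
    rintro rfl
    exact hxA haA
  have rep : ∀ p ∈ C \ {a} ∪ A, ∀ x ∈ U \ A, G.Adj p x → ∃ p' ∈ C, G.Adj p' x ∧
      ∀ y ∈ U \ A, G.Adj p' y → G.Adj p y := by
    rintro p (hp | hp) x hx hpx
    · exact ⟨p, hp.1, hpx, fun _ _ h => h⟩
    · exact ⟨a, ha, hrep p hp x hx hpx, fun y hy hay => hA hp haA hx hy hpx hay⟩
  intro p q r s hp hq hr hs hpr hqs
  obtain ⟨p', hp', hpr', hpy⟩ := rep p hp r (out r hr).1 hpr
  obtain ⟨q', hq', hqs', -⟩ := rep q hq s (out s hs).1 hqs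
  exact hpy s (out s hs).1 (h hp' hq' (out r hr).2 (out s hs).2 hpr' hqs')

end SimpleCut

namespace IsDistanceHereditary

variable {V : Type u} {G : SimpleGraph V}

theorem exists_split_subset (hG : IsDistanceHereditary G) {U : Set V} (h4 : 4 ≤ U.ncard) (z : V) :
    ∃ A ⊆ U, z ∉ A ∧ A.Nontrivial ∧ (U \ A).Nontrivial ∧ SimpleCut G U A := by
  obtain ⟨A, hA, hA', hs⟩ := (hG.induce U).exists_split h4
  have e : U \ (Subtype.val '' A) = Subtype.val '' Aᶜ := by
    ext x
    constructor
    · rintro ⟨hx, hxA⟩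
      exact ⟨⟨x, hx⟩, fun h => hxA ⟨_, h, rfl⟩, rfl⟩
    · rintro ⟨y, hy, rfl⟩
      refine ⟨y.2, ?_⟩
      rintro ⟨y', hy', h⟩
      exact hy (Subtype.val_injective h ▸ hy')
  have hsub : Subtype.val '' A ⊆ U := Subtype.coe_image_subset U A
  have hcut : SimpleCut G U (Subtype.val '' A) := by
    intro a b c d ha hb hc hd
    rw [e] at hc hd
    obtain ⟨a, ha, rfl⟩ := ha
    obtain ⟨b, hb, rfl⟩ := hb
    obtain ⟨c, hc, rfl⟩ := hc
    obtain ⟨d, hd, rfl⟩ := hd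
    exact hs ha hb ⟨trivial, hc⟩ ⟨trivial, hd⟩
  have n1 : (Subtype.val '' A).Nontrivial := hA.image Subtype.val_injective
  have n2 : (U \ Subtype.val '' A).Nontrivial := e ▸ hA'.image Subtype.val_injective
  by_cases hz : z ∈ Subtype.val '' A
  · refine ⟨_, Set.sdiff_subset, fun h => h.2 hz, n2, ?_, hcut.sdiff hsub⟩
    rwa [Set.sdiff_sdiff_cancel_left hsub]
  · exact ⟨_, hsub, hz, n1, n2, hcut⟩

theorem insert_ncard_lt {U A : Set V} (hU : U.Finite) (hAU : A ⊆ U) (hA : A.Nontrivial) (a : V) :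
    (insert a (U \ A)).ncard < U.ncard := by
  have h1 := Set.ncard_insert_le a (U \ A)
  have h2 := Set.ncard_sdiff_add_ncard_of_subset hAU hU
  have := (hU.subset hAU).to_subtype
  have h3 := Set.one_lt_ncard_iff_nontrivial.2 hA
  omega

/-- The omitted vertex `z` serves as the root of an unrooted decomposition, and its free choice is
what makes the induction close: rooting the part `insert b A` at its marker `b` leaves a hierarchy
on exactly `A`, which replaces the marker `a` in the other part. -/
theorem hierarchy_sdiff (hG : IsDistanceHereditary G) (n : ℕ) : ∀ U : Set V, U.Finite →
    U.ncard = n → U.Nontrivial → ∀ z ∈ U, Hierarchy (SimpleCut G U) (U \ {z}) := by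
  induction n using Nat.strong_induction_on with
  | _ n ih =>
  intro U hU hn hnt z hz
  by_cases h4 : 4 ≤ U.ncard
  · obtain ⟨A, hAU, hzA, hA, hB, hcut⟩ := hG.exists_split_subset h4 z
    obtain ⟨a, ha, hrep⟩ := hcut.exists_representative hA.nonempty
    have hcut' := hcut.sdiff hAU
    have eA : U \ (U \ A) = A := Set.sdiff_sdiff_cancel_left hAU
    obtain ⟨b, hb, hrep'⟩ := hcut'.exists_representative hB.nonempty
    have hBfin : (insert a (U \ A)).Finite := hU.sdiff.insert a
    have hBnt : (insert a (U \ A)).Nontrivial := hB.mono (Set.subset_insert _ _)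
    have hAfin : (insert b A).Finite := (hU.subset hAU).insert b
    have hAnt : (insert b A).Nontrivial := hA.mono (Set.subset_insert _ _)
    have lt₁ := insert_ncard_lt hU hAU hA a
    have lt₂ := insert_ncard_lt hU (Set.sdiff_subset (t := A)) hB b
    rw [eA] at lt₂
    have h₁ := ih _ (hn ▸ lt₁) _ hBfin rfl hBnt z (Or.inr ⟨hz, hzA⟩)
    have h₂ := ih _ (hn ▸ lt₂) _ hAfin rfl hAnt b (Or.inl rfl)
    rw [Set.insert_sdiff_self_of_notMem hb.2] at h₂
    have h₂' : Hierarchy (SimpleCut G U) A := by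
      refine h₂.mono fun T hT hcT => hcut'.of_insert hb hrep' ?_ ?_
      · rwa [eA]
      · rwa [eA]
    have haz : a ≠ z := fun h => hzA (h ▸ ha)
    have e : (insert a (U \ A) \ {z}) \ {a} ∪ A = U \ {z} := by
      ext x
      by_cases hx : x ∈ A
      · have h1 := hAU hx
        have h2 : x ≠ z := fun h => hzA (h ▸ hx)
        simp [hx, h1, h2]
      · have h2 : x ≠ a := fun h => hx (h ▸ ha)
        simp [hx, h2]
    rw [← e]
    refine h₁.subst h₂' ⟨Or.inl rfl, haz⟩ ?_ ?_ ?_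
    · rw [Set.disjoint_left]
      rintro x ⟨⟨hx | hx, -⟩, hxa⟩ hxA
      · exact hxa hx
      · exact hx.2 hxA
    · intro T hT haT hcT
      refine hcut.of_insert ha hrep (fun x hx => ?_) hcT
      exact (hT hx).1.resolve_left fun h => haT (h ▸ hx)
    · intro T hT haT hcT
      exact hcut.of_insert_mem ha hrep (hT.trans Set.sdiff_subset) haT hcT
  · have h1 := Set.ncard_sdiff_singleton_add_one hz hU
    have := hU.to_subtype
    have h2 := Set.one_lt_ncard_iff_nontrivial.2 hnt
    -- With at most three vertices, the only merge has the single vertex `z` on the other side.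
    have h3 : (U \ {z}).ncard = 1 ∨ (U \ {z}).ncard = 2 := by omega
    rcases h3 with h3 | h3
    · obtain ⟨a, ha⟩ := Set.ncard_eq_one.1 h3
      rw [ha]
      exact .single a
    · obtain ⟨a, b, hab, he⟩ := Set.ncard_eq_two.1 h3
      have hcut : SimpleCut G U (U \ {z}) := by
        intro p q r s hp hq hr hs hpr hqs
        rw [Set.sdiff_sdiff_cancel_left (Set.singleton_subset_iff.2 hz)] at hr hs
        rw [Set.mem_singleton_iff.1 hs, ← Set.mem_singleton_iff.1 hr]
        exact hpr
      rw [he, Set.insert_eq] at hcut ⊢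
      exact .union (.single a) (.single b) (Set.disjoint_singleton.2 hab) hcut

theorem hierarchy [Finite V] [Nonempty V] (hG : IsDistanceHereditary G) :
    Hierarchy (SimpleCut G Set.univ) Set.univ := by
  cases subsingleton_or_nontrivial V with
  | inl h =>
    obtain ⟨v⟩ := ‹Nonempty V›
    rw [Set.eq_singleton_iff_unique_mem.2 ⟨Set.mem_univ v, fun x _ => Subsingleton.elim x v⟩]
    exact .single v
  | inr h =>
    obtain ⟨z⟩ := ‹Nonempty V›
    have h1 := hG.hierarchy_sdiff _ Set.univ Set.finite_univ rfl Set.nontrivial_univ z trivial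
    have e : Set.univ \ {z} ∪ {z} = (Set.univ : Set V) := by simp
    have h2 := h1.union (.single z) Set.disjoint_sdiff_left
    rw [e] at h2
    exact h2 fun a b c d _ _ hc => absurd hc.1 hc.2

end IsDistanceHereditary

/-! ### Modules and cographs -/

/-- Vertices outside a module are adjacent to all or to none of its vertices. -/
def IsModule {V : Type u} (G : SimpleGraph V) (A : Set V) : Prop :=
  ∀ ⦃a b c : V⦄, a ∈ A → b ∈ A → c ∉ A → G.Adj a c → G.Adj b c

theorem IsModule.simpleCut {V : Type u} {G : SimpleGraph V} {A : Set V} (h : IsModule G A) :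
    SimpleCut G Set.univ A :=
  fun _ _ _ _ ha hb _ hd _ hbd => h hb ha hd.2 hbd

namespace Hierarchy

variable {V : Type u} {P : Set V → Prop} {S : Set V}

theorem prop (h : Hierarchy P S) (hs : ∀ v, P {v}) : P S := by
  cases h with
  | single v => exact hs v
  | union _ _ _ hP => exact hP

end Hierarchy

/-- Modules of a summand are modules of the disjoint union, complementation preserves modules, and
the full vertex set is trivially one. -/
theorem IsCograph.hierarchy {V : Type u} {G : SimpleGraph V} (h : IsCograph G) :
    Hierarchy (IsModule G) Set.univ := by
  induction h with
  | single G =>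
    rw [Set.univ_unique]
    exact .single _
  | @sum V W G H _ _ ih₁ ih₂ =>
    have h₁ : Hierarchy (IsModule (G.sum H)) (Sum.inl '' Set.univ) := by
      refine ih₁.map Sum.inl_injective fun T hT => ?_
      rintro _ _ (c | c) ⟨a, ha, rfl⟩ ⟨b, hb, rfl⟩ hc hac
      · exact hT ha hb (fun h => hc ⟨c, h, rfl⟩) hac
      · simp at hac
    have h₂ : Hierarchy (IsModule (G.sum H)) (Sum.inr '' Set.univ) := by
      refine ih₂.map Sum.inr_injective fun T hT => ?_
      rintro _ _ (c | c) ⟨a, ha, rfl⟩ ⟨b, hb, rfl⟩ hc hac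
      · simp at hac
      · exact hT ha hb (fun h => hc ⟨c, h, rfl⟩) hac
    have h₃ := h₁.union h₂
    simp only [Set.image_univ, Set.range_inl_union_range_inr] at h₃
    exact h₃ (Set.isCompl_range_inl_range_inr.disjoint) fun a b c _ _ hc => absurd trivial hc
  | compl _ ih =>
    refine ih.mono fun T _ hT a b c ha hb hc hac => ?_
    rw [SimpleGraph.compl_adj] at hac ⊢
    exact ⟨fun h => hc (h ▸ hb), fun h => hac.2 (hT hb ha hc h)⟩
  | @iso V W G H e _ ih =>
    have := ih.map (R := IsModule H) e.injective fun T hT => by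
      rintro _ _ c ⟨a, ha, rfl⟩ ⟨b, hb, rfl⟩ hc hac
      obtain ⟨c, rfl⟩ := e.surjective c
      rw [e.map_adj_iff] at hac ⊢
      exact hT ha hb (fun h => hc ⟨c, h, rfl⟩) hac
    rwa [Set.image_univ, e.surjective.range_eq] at this

namespace IsCograph

theorem of_no_cross_edges {V : Type u} {G : SimpleGraph V} (S : Set V)
    (hS : ∀ a ∈ S, ∀ b ∉ S, ¬ G.Adj a b) (h₁ : IsCograph (G.induce S))
    (h₂ : IsCograph (G.induce Sᶜ)) : IsCograph G := by
  classical
  refine IsCograph.iso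
    { toEquiv := Equiv.Set.sumCompl S
      map_rel_iff' := ?_ } (h₁.sum h₂)
  rintro (⟨a, ha⟩ | ⟨a, ha⟩) (⟨b, hb⟩ | ⟨b, hb⟩)
  · simp
  · simpa using hS a ha b hb
  · simpa using fun h => hS b hb a ha (G.adj_symm h)
  · simp

theorem comap_compl {V W : Type u} (G : SimpleGraph V) {f : W → V} (hf : Function.Injective f) :
    Gᶜ.comap f = (G.comap f)ᶜ := by
  ext a b
  simp [hf.ne_iff]

theorem of_all_cross_edges {V : Type u} {G : SimpleGraph V} (S : Set V)
    (hS : ∀ a ∈ S, ∀ b ∉ S, G.Adj a b) (h₁ : IsCograph (G.induce S))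
    (h₂ : IsCograph (G.induce Sᶜ)) : IsCograph G := by
  rw [← compl_compl G]
  refine (of_no_cross_edges S (fun a ha b hb h => ?_) ?_ ?_).compl
  · exact h.2 (hS a ha b hb)
  · change IsCograph (Gᶜ.comap (Subtype.val : S → V))
    rw [comap_compl G Subtype.val_injective]
    exact h₁.compl
  · change IsCograph (Gᶜ.comap (Subtype.val : (Sᶜ : Set V) → V))
    rw [comap_compl G Subtype.val_injective]
    exact h₂.compl

/-- Nonempty induced subgraphs of cographs are cographs. -/
theorem comap {V : Type u} {G : SimpleGraph V} (h : IsCograph G) :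
    ∀ {W : Type u} [Nonempty W] (f : W → V), Function.Injective f → IsCograph (G.comap f) := by
  induction h with
  | single G =>
    intro W _ f hf
    have : Subsingleton W := hf.subsingleton
    obtain ⟨w⟩ := ‹Nonempty W›
    have : Unique W := uniqueOfSubsingleton w
    exact .single _
  | @sum V₁ V₂ G H _ _ ih₁ ih₂ =>
    have left : ∀ {X : Type u} [Nonempty X] (g : X → V₁ ⊕ V₂), Function.Injective g →
        (∀ x, ∃ v, Sum.inl v = g x) → IsCograph ((G.sum H).comap g) := by
      intro X _ g hg hv
      choose g' hg' using hv
      obtain rfl : g = Sum.inl ∘ g' := funext fun x => (hg' x).symm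
      exact ih₁ g' hg.of_comp
    have right : ∀ {X : Type u} [Nonempty X] (g : X → V₁ ⊕ V₂), Function.Injective g →
        (∀ x, ∃ v, Sum.inr v = g x) → IsCograph ((G.sum H).comap g) := by
      intro X _ g hg hv
      choose g' hg' using hv
      obtain rfl : g = Sum.inr ∘ g' := funext fun x => (hg' x).symm
      exact ih₂ g' hg.of_comp
    intro W _ f hf
    by_cases hl : ∀ w, ∃ v, Sum.inl v = f w
    · exact left f hf hl
    by_cases hr : ∀ w, ∃ v, Sum.inr v = f w
    · exact right f hf hr
    push Not at hl hr
    have hcase : ∀ w, (∃ v, Sum.inl v = f w) ∨ ∃ v, Sum.inr v = f w := by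
      intro w
      cases f w <;> simp
    obtain ⟨w₁, h₁⟩ := hr
    obtain ⟨w₂, h₂⟩ := hl
    let S : Set W := {w | ∃ v, Sum.inl v = f w}
    have hw₁ : w₁ ∈ S := (hcase w₁).resolve_right fun ⟨v, hv⟩ => h₁ v hv
    have hw₂ : w₂ ∈ Sᶜ := fun ⟨v, hv⟩ => h₂ v hv
    refine of_no_cross_edges S ?_ ?_ ?_
    · rintro a ⟨v, hv⟩ b hb hab
      obtain ⟨w, hw⟩ := (hcase b).resolve_left hb
      simp [← hv, ← hw] at hab
    · have : Nonempty S := ⟨⟨w₁, hw₁⟩⟩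
      exact left (fun w : S => f w) (hf.comp Subtype.val_injective) fun w => w.2
    · have : Nonempty (Sᶜ : Set W) := ⟨⟨w₂, hw₂⟩⟩
      exact right (fun w : (Sᶜ : Set W) => f w) (hf.comp Subtype.val_injective)
        fun w => (hcase w).resolve_left w.2
  | @compl V G _ ih =>
    intro W _ f hf
    rw [comap_compl G hf]
    exact (ih f hf).compl
  | @iso V V' G H e _ ih =>
    intro W _ f hf
    have : H.comap f = G.comap (e.symm ∘ f) := by
      ext a b
      simp [e.symm.map_adj_iff]
    rw [this]
    exact ih _ (e.symm.injective.comp hf)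

/-- Vertices of expressions live in `Type`, those of the given graph in an arbitrary universe; this
bridges the two. -/
theorem ulift {V : Type} {G : SimpleGraph V} (h : IsCograph G) :
    IsCograph (G.comap (ULift.down.{u} : ULift.{u} V → V)) := by
  induction h with
  | single G => exact .single _
  | @sum V W G H _ _ ih₁ ih₂ =>
    refine IsCograph.iso
      { toEquiv := (Equiv.sumCongr Equiv.ulift Equiv.ulift).trans Equiv.ulift.symm
        map_rel_iff' := ?_ } (ih₁.sum ih₂)
    rintro (a | a) (b | b) <;> simp
  | @compl V G _ ih =>
    have : Gᶜ.comap (ULift.down.{u} : ULift.{u} V → V) = (G.comap ULift.down)ᶜ := by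
      ext a b
      simp [ULift.down_injective.ne_iff]
    rw [this]
    exact ih.compl
  | @iso V W G H e _ ih =>
    refine IsCograph.iso
      { toEquiv := (Equiv.ulift.trans e.toEquiv).trans Equiv.ulift.symm
        map_rel_iff' := ?_ } ih
    intro a b
    exact e.map_adj_iff

end IsCograph

/-! ### Clique-width expressions -/

namespace CliqueExpr

instance {k : ℕ} (t : CliqueExpr k) : Nonempty t.Verts := by
  induction t with
  | vertex i => exact ⟨()⟩
  | union s t ihs _ => exact ⟨Sum.inl ihs.some⟩
  | join i j hij t ih => exact ih
  | relabel i j t ih => exact ih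

/-- With two labels, a join makes the two label classes completely adjacent and changes nothing
inside them, so it is a complement of a disjoint union of induced subgraphs, which are cographs. If
a class is empty, the join does nothing. -/
theorem isCograph {k : ℕ} (hk : k ≤ 2) (t : CliqueExpr k) : IsCograph t.graph := by
  induction t with
  | vertex i => exact IsCograph.single (V := Unit) ⊥
  | union s t ihs iht => exact ihs.sum iht
  | relabel i j t ih => exact ih
  | join i j hij t ih =>
    have hlab : ∀ v, t.label v = i ∨ t.label v = j := by
      intro v
      have h1 := (t.label v).isLt
      have h2 := i.isLt
      have h3 := j.isLt
      simp only [Fin.ext_iff, ne_eq] at hij ⊢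
      omega
    let S : Set t.Verts := {v | t.label v = i}
    let H : SimpleGraph t.Verts :=
      t.graph ⊔ SimpleGraph.fromRel (fun a b => t.label a = i ∧ t.label b = j)
    change IsCograph H
    by_cases h₁ : ∃ v, t.label v = i
    · by_cases h₂ : ∃ v, t.label v = j
      · have ind : ∀ T : Set t.Verts, (∃ l, ∀ v ∈ T, t.label v = l) → T.Nonempty →
            IsCograph (H.induce T) := by
          rintro T ⟨l, hl⟩ hT
          have : Nonempty T := hT.to_subtype
          have e : H.induce T = t.graph.comap (Subtype.val : T → t.Verts) := by
            ext a b
            have ha := hl a a.2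
            have hb := hl b b.2
            simp only [H, SimpleGraph.comap_adj, SimpleGraph.sup_adj, SimpleGraph.fromRel_adj,
              Function.Embedding.subtype_apply, ha, hb]
            refine ⟨fun h => h.resolve_right ?_, Or.inl⟩
            rintro ⟨-, ⟨h, h'⟩ | ⟨h, h'⟩⟩ <;> exact hij (h.symm.trans h')
          rw [e]
          exact ih.comap _ Subtype.val_injective
        refine IsCograph.of_all_cross_edges S ?_ (ind S ⟨i, fun v hv => hv⟩ h₁)
          (ind Sᶜ ⟨j, fun v hv => (hlab v).resolve_left hv⟩ ?_)
        · intro a ha b hb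
          refine Or.inr ⟨fun h => hb (h ▸ ha), Or.inl ⟨ha, (hlab b).resolve_left hb⟩⟩
        · obtain ⟨v, hv⟩ := h₂
          exact ⟨v, fun h => hij (Eq.trans (Eq.symm h) hv)⟩
      · have e : H = t.graph := by
          refine sup_eq_left.2 fun a b hab => ?_
          rcases hab with ⟨-, ⟨-, h⟩ | ⟨-, h⟩⟩ <;> exact absurd ⟨_, h⟩ h₂
        rw [e]
        exact ih
    · have e : H = t.graph := by
        refine sup_eq_left.2 fun a b hab => ?_
        rcases hab with ⟨-, ⟨h, -⟩ | ⟨h, -⟩⟩ <;> exact absurd ⟨_, h⟩ h₁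
      rw [e]
      exact ih

end CliqueExpr

theorem cliqueWidth_le_iff {V : Type u} (G : SimpleGraph V) (n : ℕ) :
    cliqueWidth G ≤ n ↔ ∃ k ≤ n, ∃ t : CliqueExpr k, Nonempty (G ≃g t.graph) := by
  constructor
  · intro h
    by_contra! hcon
    have : ((n + 1 : ℕ) : ℕ∞) ≤ cliqueWidth G := by
      refine le_iInf₂ fun k ⟨t, ht⟩ => ?_
      by_contra! hk
      have hk' : k ≤ n := by exact_mod_cast Order.lt_add_one_iff.1 (by exact_mod_cast hk)
      exact (not_isEmpty_iff.2 ht) (hcon k hk' t)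
    have := this.trans h
    norm_cast at this
    omega
  · rintro ⟨k, hk, t, ht⟩
    exact (iInf₂_le k ⟨t, ht⟩).trans (by exact_mod_cast hk)

theorem IsCograph.of_cliqueWidth_le_two {V : Type u} {G : SimpleGraph V}
    (h : cliqueWidth G ≤ 2) : IsCograph G := by
  obtain ⟨k, hk, t, ⟨e⟩⟩ := (cliqueWidth_le_iff G 2).1 h
  refine IsCograph.iso ?_ (t.isCograph hk).ulift
  exact
    { toEquiv := Equiv.ulift.trans e.symm.toEquiv
      map_rel_iff' := by
        intro a b
        exact e.symm.map_adj_iff }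

namespace CliqueExpr

variable {V : Type u} {G : SimpleGraph V} {k : ℕ}

/-- The expression `t` describes the subgraph of `G` induced by `A`, where `f` identifies the vertices
of the expression with those of `A`. -/
structure Describes (G : SimpleGraph V) (t : CliqueExpr k) (A : Set V) (f : t.Verts → V) : Prop where
  injective : Function.Injective f
  range_eq : Set.range f = A
  adj_iff : ∀ x y, t.graph.Adj x y ↔ G.Adj (f x) (f y)

theorem Describes.vertex (i : Fin k) (v : V) :
    Describes G (CliqueExpr.vertex i) {v} (fun _ => v) where
  injective := fun _ _ _ => rfl
  range_eq := Set.range_const (ι := Unit)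
  adj_iff := fun _ _ => iff_of_false (fun h => h) (G.loopless.irrefl v)

theorem Describes.iso {t : CliqueExpr k} {f : t.Verts → V} (h : Describes G t Set.univ f) :
    Nonempty (G ≃g t.graph) :=
  ⟨(SimpleGraph.Iso.symm
    { toEquiv := Equiv.ofBijective f ⟨h.injective, Set.range_eq_univ.1 h.range_eq⟩
      map_rel_iff' := fun {a b} => (h.adj_iff a b).symm })⟩

theorem Describes.relabel {t : CliqueExpr k} {A : Set V} {f : t.Verts → V}
    (h : Describes G t A f) (i j : Fin k) : Describes G (CliqueExpr.relabel i j t) A f :=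
  ⟨h.injective, h.range_eq, h.adj_iff⟩

variable {s t : CliqueExpr k} {A B : Set V} {f : s.Verts → V} {g : t.Verts → V}

theorem Describes.union (hs : Describes G s A f) (ht : Describes G t B g) (hd : Disjoint A B)
    (hcross : ∀ x y, ¬ G.Adj (f x) (g y)) :
    Describes G (CliqueExpr.union s t) (A ∪ B) (Sum.elim f g) where
  injective := by
    refine hs.injective.sumElim ht.injective fun x y => ?_
    exact hd.ne_of_mem (hs.range_eq ▸ ⟨x, rfl⟩) (ht.range_eq ▸ ⟨y, rfl⟩)
  range_eq := by
    refine Set.Sum.elim_range f g |>.trans ?_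
    rw [hs.range_eq, ht.range_eq]
  adj_iff := by
    rintro (x | x) (y | y)
    · exact hs.adj_iff x y
    · simpa [graph] using hcross x y
    · simpa [graph] using fun h => hcross y x (G.adj_symm h)
    · exact ht.adj_iff x y

theorem Describes.join_union (hs : Describes G s A f) (ht : Describes G t B g) (hd : Disjoint A B)
    {i j : Fin k} (hij : i ≠ j) (hsj : ∀ x, s.label x ≠ j) (hti : ∀ y, t.label y ≠ i)
    (hcross : ∀ x y, G.Adj (f x) (g y) ↔ s.label x = i ∧ t.label y = j) :
    Describes G (CliqueExpr.join i j hij (CliqueExpr.union s t)) (A ∪ B) (Sum.elim f g) where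
  injective := by
    refine hs.injective.sumElim ht.injective fun x y => ?_
    exact hd.ne_of_mem (hs.range_eq ▸ ⟨x, rfl⟩) (ht.range_eq ▸ ⟨y, rfl⟩)
  range_eq := by
    refine Set.Sum.elim_range f g |>.trans ?_
    rw [hs.range_eq, ht.range_eq]
  adj_iff := by
    have key : ∀ a b : s.Verts ⊕ t.Verts,
        (CliqueExpr.join i j hij (CliqueExpr.union s t)).graph.Adj a b ↔
          (s.graph.sum t.graph).Adj a b ∨ a ≠ b ∧
            (Sum.elim s.label t.label a = i ∧ Sum.elim s.label t.label b = j ∨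
              Sum.elim s.label t.label b = i ∧ Sum.elim s.label t.label a = j) :=
      fun _ _ => Iff.rfl
    rintro (x | x) (y | y)
    · rw [key]
      simpa [hsj] using hs.adj_iff x y
    · rw [key]
      simpa [hsj, hti] using (hcross x y).symm
    · rw [key]
      have := hcross y x
      rw [G.adj_comm] at this
      simpa [hsj, hti, and_comm] using this.symm
    · rw [key]
      simpa [hti] using ht.adj_iff x y

end CliqueExpr

namespace Hierarchy

variable {V : Type u} {G : SimpleGraph V} {S : Set V}

open CliqueExpr

/-- Two disjoint modules are joined completely or not at all, so one label per set is enough; the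
second is needed only during the join. -/
theorem exists_cliqueExpr_two (h : Hierarchy (IsModule G) S) :
    ∃ (t : CliqueExpr 2) (f : t.Verts → V), Describes G t S f ∧ ∀ x, t.label x = 0 := by
  induction h with
  | single v => exact ⟨.vertex 0, fun _ => v, .vertex 0 v, fun _ => rfl⟩
  | @union A B hA hB hd _ ihA ihB =>
    obtain ⟨s, f, hs, hs0⟩ := ihA
    obtain ⟨t, g, ht, ht0⟩ := ihB
    have single : ∀ v, IsModule G {v} := by
      rintro v _ _ c rfl rfl - h
      exact h
    have mA := hA.prop single
    have mB := hB.prop single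
    have hfA : ∀ x, f x ∈ A := fun x => hs.range_eq ▸ ⟨x, rfl⟩
    have hgB : ∀ y, g y ∈ B := fun y => ht.range_eq ▸ ⟨y, rfl⟩
    by_cases hc : ∃ x y, G.Adj (f x) (g y)
    · obtain ⟨x₀, y₀, h₀⟩ := hc
      have ht1 : ∀ y, (CliqueExpr.relabel 0 1 t).label y = 1 := fun y => if_pos (ht0 y)
      refine ⟨.relabel 1 0 (.join 0 1 (by decide) (.union s (.relabel 0 1 t))), Sum.elim f g,
        ((hs.join_union (ht.relabel 0 1) hd _ ?_ ?_ ?_).relabel 1 0), ?_⟩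
      · intro x
        rw [hs0]
        decide
      · intro y
        rw [ht1]
        decide
      · intro x y
        refine iff_of_true ?_ ⟨hs0 x, ht1 y⟩
        have h1 := mA (hfA x₀) (hfA x) (fun h => hd.notMem_of_mem_left h (hgB y₀)) h₀
        exact (mB (hgB y₀) (hgB y) (hd.notMem_of_mem_left (hfA x)) h1.symm).symm
      · rintro (x | y)
        · change (if s.label x = 1 then 0 else s.label x) = 0
          simp [hs0]
        · change (if (CliqueExpr.relabel 0 1 t).label y = 1 then 0 else _) = 0
          rw [if_pos (ht1 y)]
    · push Not at hc
      refine ⟨.union s t, Sum.elim f g, hs.union ht hd hc, ?_⟩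
      rintro (x | y)
      · exact hs0 x
      · exact ht0 y

-- Label 1 marks the active vertices, those with a neighbour outside the current set. All active
-- vertices of a set look alike from outside, so two active groups with a cross edge are completely
-- adjacent.
open Classical in
theorem exists_cliqueExpr_three (h : Hierarchy (SimpleCut G Set.univ) S) :
    ∃ (t : CliqueExpr 3) (f : t.Verts → V), Describes G t S f ∧
      ∀ x, t.label x = if ∃ c ∉ S, G.Adj (f x) c then 1 else 0 := by
  induction h with
  | single v =>
    exact ⟨.vertex (if ∃ c ∉ ({v} : Set V), G.Adj v c then 1 else 0), fun _ => v, .vertex _ v,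
      fun _ => rfl⟩
  | @union A B hA hB hd _ ihA ihB =>
    obtain ⟨s, f, hs, hsl⟩ := ihA
    obtain ⟨t, g, ht, htl⟩ := ihB
    have single : ∀ v, SimpleCut G Set.univ {v} := by
      rintro v _ _ c d rfl rfl - - - h
      exact h
    have mA := hA.prop single
    have mB := hB.prop single
    have hfA : ∀ x, f x ∈ A := fun x => hs.range_eq ▸ ⟨x, rfl⟩
    have hgB : ∀ y, g y ∈ B := fun y => ht.range_eq ▸ ⟨y, rfl⟩
    have ht' := ht.relabel 1 2
    have htl' : ∀ y, (CliqueExpr.relabel 1 2 t).label y =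
        if ∃ c ∉ B, G.Adj (g y) c then 2 else 0 := by
      intro (y : t.Verts)
      change (if t.label y = 1 then 2 else t.label y) = _
      rw [htl]
      split_ifs <;> simp_all
    -- an expression for the union in which the active vertices of `A` and `B` have labels 1 and 2
    obtain ⟨u, φ, hu, hul⟩ : ∃ (u : CliqueExpr 3) (φ : u.Verts → V), Describes G u (A ∪ B) φ ∧
        ∀ x, (φ x ∈ A ∧ u.label x = if ∃ c ∉ A, G.Adj (φ x) c then 1 else 0) ∨
          (φ x ∈ B ∧ u.label x = if ∃ c ∉ B, G.Adj (φ x) c then 2 else 0) := by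
      by_cases hc : ∃ x y, G.Adj (f x) (g y)
      · obtain ⟨x₀, y₀, h₀⟩ := hc
        refine ⟨.join 1 2 (by decide) (.union s (.relabel 1 2 t)), Sum.elim f g,
          hs.join_union ht' hd _ ?_ ?_ ?_, ?_⟩
        · intro x
          rw [hsl]
          split_ifs <;> decide
        · intro y
          rw [htl']
          split_ifs <;> decide
        · intro x y
          have hAB : ∀ y, g y ∉ A := fun y h => hd.notMem_of_mem_left h (hgB y)
          have hBA : ∀ x, f x ∉ B := fun x => hd.notMem_of_mem_left (hfA x)
          rw [hsl, htl']
          constructor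
          · intro h
            rw [if_pos ⟨_, hAB y, h⟩, if_pos ⟨_, hBA x, h.symm⟩]
            exact ⟨rfl, rfl⟩
          · rintro ⟨h1, h2⟩
            have h1' : ∃ c ∉ A, G.Adj (f x) c := by
              by_contra h
              rw [if_neg h] at h1
              exact absurd h1 (by decide)
            have h2' : ∃ c ∉ B, G.Adj (g y) c := by
              by_contra h
              rw [if_neg h] at h2
              exact absurd h2 (by decide)
            obtain ⟨c, hc, hxc⟩ := h1'
            obtain ⟨d, hd', hyd⟩ := h2'
            have h3 := mA (hfA x) (hfA x₀) ⟨trivial, hc⟩ ⟨trivial, hAB y₀⟩ hxc h₀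
            exact (mB (hgB y) (hgB y₀) ⟨trivial, hd'⟩ ⟨trivial, hBA x⟩ hyd h3.symm).symm
        · rintro (x | y)
          · exact Or.inl ⟨hfA x, hsl x⟩
          · exact Or.inr ⟨hgB y, htl' y⟩
      · push Not at hc
        refine ⟨.union s (.relabel 1 2 t), Sum.elim f g, hs.union ht' hd hc, ?_⟩
        rintro (x | y)
        · exact Or.inl ⟨hfA x, hsl x⟩
        · exact Or.inr ⟨hgB y, htl' y⟩
    -- When `C` grows to `D`, its active vertices stay active all together or not at all, so one
    -- relabelling per group restores the invariant.
    have key : ∀ C, SimpleCut G Set.univ C → ∀ D, C ⊆ D → ∀ v ∈ C,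
        (∃ c ∉ D, G.Adj v c) ↔ (∃ c ∉ C, G.Adj v c) ∧ ∃ w ∈ C, ∃ c ∉ D, G.Adj w c := by
      intro C hC D hCD v hv
      constructor
      · rintro ⟨c, hc, hvc⟩
        exact ⟨⟨c, fun h => hc (hCD h), hvc⟩, v, hv, c, hc, hvc⟩
      · rintro ⟨⟨c, hc, hvc⟩, w, hw, d, hd, hwd⟩
        exact ⟨d, hd, hC hv hw ⟨trivial, hc⟩ ⟨trivial, fun h => hd (hCD h)⟩ hvc hwd⟩
    -- Label 1 is treated before label 2; in the other order, vertices of `B` just moved to 1 could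
    -- be deactivated with those of `A`.
    refine ⟨.relabel 2 (if ∃ w ∈ B, ∃ c ∉ A ∪ B, G.Adj w c then 1 else 0)
      (.relabel 1 (if ∃ w ∈ A, ∃ c ∉ A ∪ B, G.Adj w c then 1 else 0) u), φ,
      (hu.relabel _ _).relabel _ _, fun x => ?_⟩
    change (if (if u.label x = 1 then _ else u.label x) = 2 then _ else
      (if u.label x = 1 then _ else u.label x)) = _
    rcases hul x with ⟨hx, hl⟩ | ⟨hx, hl⟩
    · rw [hl, if_congr (key A mA (A ∪ B) Set.subset_union_left _ hx) rfl rfl]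
      generalize (∃ w ∈ A, ∃ c ∉ A ∪ B, G.Adj w c) = p
      generalize (∃ c ∉ A, G.Adj (φ x) c) = q
      by_cases hp : p <;> by_cases hq : q <;> simp [hp, hq]
    · rw [hl, if_congr (key B mB (A ∪ B) Set.subset_union_right _ hx) rfl rfl]
      generalize (∃ w ∈ B, ∃ c ∉ A ∪ B, G.Adj w c) = p
      generalize (∃ c ∉ B, G.Adj (φ x) c) = q
      by_cases hp : p <;> by_cases hq : q <;> simp [hp, hq]

end Hierarchy

theorem IsCograph.cliqueWidth_le_two {V : Type u} {G : SimpleGraph V} (h : IsCograph G) :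
    cliqueWidth G ≤ 2 := by
  obtain ⟨t, f, ht, -⟩ := h.hierarchy.exists_cliqueExpr_two
  exact (cliqueWidth_le_iff G 2).2 ⟨2, le_rfl, t, ht.iso⟩

theorem IsDistanceHereditary.cliqueWidth_le_three {V : Type u} [Finite V] [Nonempty V]
    {G : SimpleGraph V} (h : IsDistanceHereditary G) : cliqueWidth G ≤ 3 := by
  obtain ⟨t, f, ht, -⟩ := h.hierarchy.exists_cliqueExpr_three
  exact (cliqueWidth_le_iff G 3).2 ⟨3, le_rfl, t, ht.iso⟩

/-! ### From hierarchies to branch decompositions -/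

/-- A finite rooted binary tree of subsets of `V`. Nodes are lists of booleans, the children of `w`
are `true :: w` and `false :: w`, and the sets at the children partition the set at `w`; a node is a
leaf if its set is a singleton. -/
structure PartitionTree (V : Type u) where
  N : Set (List Bool)
  A : List Bool → Set V
  nil_mem : [] ∈ N
  nil_eq : A [] = Set.univ
  cons_mem : ∀ b w, b :: w ∈ N ↔ w ∈ N ∧ ¬ (A w).Subsingleton
  nonempty : ∀ w ∈ N, (A w).Nonempty
  mem_iff : ∀ w ∈ N, ¬ (A w).Subsingleton → ∀ v, v ∈ A w ↔ ∃ b, v ∈ A (b :: w)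
  eq_of_mem : ∀ w ∈ N, ¬ (A w).Subsingleton → ∀ v b b', v ∈ A (b :: w) → v ∈ A (b' :: w) → b = b'

namespace PartitionTree

variable {V : Type u} (T : PartitionTree V)

theorem cons_subset {b : Bool} {w : List Bool} (h : b :: w ∈ T.N) : T.A (b :: w) ⊆ T.A w := by
  obtain ⟨hw, hs⟩ := (T.cons_mem b w).1 h
  exact fun v hv => (T.mem_iff w hw hs v).2 ⟨b, hv⟩

theorem mem_of_suffix {w x : List Bool} (h : w <:+ x) (hx : x ∈ T.N) : w ∈ T.N := by
  induction x with
  | nil => rwa [List.suffix_nil.1 h]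
  | cons b x ih =>
    rcases List.suffix_cons_iff.1 h with rfl | h
    · exact hx
    · exact ih h ((T.cons_mem b x).1 hx).1

theorem subset_of_suffix {w x : List Bool} (h : w <:+ x) (hx : x ∈ T.N) : T.A x ⊆ T.A w := by
  induction x with
  | nil => rw [List.suffix_nil.1 h]
  | cons b x ih =>
    rcases List.suffix_cons_iff.1 h with rfl | h
    · exact subset_rfl
    · exact (T.cons_subset hx).trans (ih h ((T.cons_mem b x).1 hx).1)

theorem eq_or_cons_suffix {w x : List Bool} (h : w <:+ x) : w = x ∨ ∃ b, b :: w <:+ x := by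
  induction x with
  | nil => exact Or.inl (List.suffix_nil.1 h)
  | cons b x ih =>
    rcases List.suffix_cons_iff.1 h with rfl | h
    · exact Or.inl rfl
    · rcases ih h with rfl | ⟨b', h'⟩
      · exact Or.inr ⟨b, List.suffix_rfl⟩
      · exact Or.inr ⟨b', List.suffix_cons_iff.2 (Or.inr h')⟩

theorem suffix_or_suffix {x y : List Bool} (hx : x ∈ T.N) (hy : y ∈ T.N) {v : V}
    (hvx : v ∈ T.A x) (hvy : v ∈ T.A y) : x <:+ y ∨ y <:+ x := by
  induction x with
  | nil => exact Or.inl List.nil_suffix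
  | cons b w ih =>
    obtain ⟨hw, hs⟩ := (T.cons_mem b w).1 hx
    rcases ih hw (T.cons_subset hx hvx) with h | h
    · rcases eq_or_cons_suffix h with rfl | ⟨b', h'⟩
      · exact Or.inr (List.suffix_cons b w)
      · obtain rfl := T.eq_of_mem w hw hs v b b' hvx (T.subset_of_suffix h' hy hvy)
        exact Or.inl h'
    · exact Or.inr (List.suffix_cons_iff.2 (Or.inr h))

theorem eq_of_suffix {x y : List Bool} (hy : y ∈ T.N) (hs : (T.A x).Subsingleton) (h : x <:+ y) :
    x = y := by
  rcases eq_or_cons_suffix h with h' | ⟨b, h'⟩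
  · exact h'
  · exact absurd hs ((T.cons_mem b x).1 (T.mem_of_suffix h' hy)).2

/-- Sets shrink strictly along each branch, as the sibling is nonempty; this bounds the depth and
makes the tree finite. -/
theorem ncard_add_length_le [Finite V] {w : List Bool} (hw : w ∈ T.N) :
    (T.A w).ncard + w.length ≤ Nat.card V := by
  induction w with
  | nil => simp [T.nil_eq]
  | cons b w ih =>
    obtain ⟨hw', hs⟩ := (T.cons_mem b w).1 hw
    have h1 := ih hw'
    have h2 : (T.A (b :: w)).ncard < (T.A w).ncard := by
      refine Set.ncard_lt_ncard ⟨T.cons_subset hw, fun hsub => ?_⟩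
      obtain ⟨v, hv⟩ := T.nonempty _ ((T.cons_mem (!b) w).2 ⟨hw', hs⟩)
      have := T.eq_of_mem w hw' hs v b (!b) (hsub ((T.mem_iff w hw' hs v).2 ⟨_, hv⟩)) hv
      simp at this
    rw [List.length_cons]
    omega

theorem finite [Finite V] : T.N.Finite :=
  (List.finite_length_le Bool (Nat.card V)).subset fun w hw => by
    have := T.ncard_add_length_le hw
    rw [Set.mem_ofPred_eq]
    omega

theorem exists_leaf [Finite V] (v : V) : ∃ x : T.N, T.A x = {v} := by
  obtain ⟨x, ⟨hx, hv⟩, hmax⟩ := Set.exists_max_image {x | x ∈ T.N ∧ v ∈ T.A x} List.length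
    (T.finite.subset fun x hx => hx.1) ⟨[], T.nil_mem, T.nil_eq ▸ trivial⟩
  by_cases hs : (T.A x).Subsingleton
  · exact ⟨⟨x, hx⟩, hs.eq_singleton_of_mem hv⟩
  · obtain ⟨b, hb⟩ := (T.mem_iff x hx hs v).1 hv
    have := hmax (b :: x) ⟨(T.cons_mem b x).2 ⟨hx, hs⟩, hb⟩
    simp at this

/-- The underlying graph of the tree. -/
def graph : SimpleGraph T.N where
  Adj x y := (∃ b, (x : List Bool) = b :: y) ∨ ∃ b, (y : List Bool) = b :: x
  symm := ⟨fun _ _ h => h.symm⟩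
  loopless := ⟨fun x h => by
    rcases h with ⟨b, h⟩ | ⟨b, h⟩ <;> simpa using congrArg List.length h⟩

theorem mem_treeLeaves_iff (x : T.N) : x ∈ treeLeaves T.graph ↔ (T.A x).Subsingleton := by
  constructor
  · intro h
    by_contra hs
    have hc : ∀ b, b :: (x : List Bool) ∈ T.N := fun b => (T.cons_mem b x).2 ⟨x.2, hs⟩
    have := Set.encard_le_one_iff.1 h ⟨_, hc true⟩ ⟨_, hc false⟩ (Or.inr ⟨true, rfl⟩)
      (Or.inr ⟨false, rfl⟩)
    simp at this
  · intro hs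
    refine Set.encard_le_one_iff.2 fun y z hy hz => Subtype.ext ?_
    have key : ∀ y : T.N, T.graph.Adj x y → ∃ b, (x : List Bool) = b :: y := by
      rintro y (h | ⟨b, h⟩)
      · exact h
      · exact absurd hs ((T.cons_mem b x).1 (h ▸ y.2)).2
    obtain ⟨b, hb⟩ := key y hy
    obtain ⟨c, hc⟩ := key z hz
    exact (List.cons.inj (hb.symm.trans hc)).2

theorem encard_neighborSet_le (x : T.N) : (T.graph.neighborSet x).encard ≤ 3 := by
  rw [← Subtype.val_injective.encard_image]
  have hsub : Subtype.val '' T.graph.neighborSet x ⊆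
      {(x : List Bool).tail, true :: (x : List Bool), false :: (x : List Bool)} := by
    rintro _ ⟨y, ⟨b, h⟩ | ⟨b, h⟩, rfl⟩
    · simp [h]
    · cases b <;> simp [h]
  refine (Set.encard_le_encard hsub).trans ?_
  refine (Set.encard_insert_le _ _).trans ?_
  calc _ ≤ ((1 : ℕ∞) + 1) + 1 := by
        gcongr
        exact (Set.encard_insert_le _ _).trans (by rw [Set.encard_singleton])
    _ = 3 := by norm_num

/-- The root of the tree. -/
def root : T.N := ⟨[], T.nil_mem⟩

section Edge

variable {T} {x y : T.N} {b : Bool}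

/-- The deleted edge is the only one leaving the subtree of `y`. -/
theorem suffix_of_reachable (h : (y : List Bool) = b :: x) {p q : T.N}
    (hr : (T.graph.deleteEdges {s(x, y)}).Reachable p q) (hp : (y : List Bool) <:+ p) :
    (y : List Bool) <:+ q := by
  obtain ⟨w⟩ := hr
  induction w with
  | nil => exact hp
  | @cons p q _ hpq _ ih =>
    refine ih ?_
    rw [SimpleGraph.deleteEdges_adj] at hpq
    obtain ⟨⟨c, hc⟩ | ⟨c, hc⟩, hne⟩ := hpq
    · rw [hc] at hp
      rcases List.suffix_cons_iff.1 hp with h' | h'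
      · refine absurd ?_ hne
        have e1 : p = y := Subtype.ext (hc.trans h'.symm)
        have e2 : q = x := Subtype.ext (List.cons.inj (h'.symm.trans h)).2
        rw [e1, e2, Sym2.eq_swap]
        rfl
      · exact h'
    · rw [hc]
      exact List.suffix_cons_iff.2 (Or.inr hp)

theorem adj_deleteEdges (h : (y : List Bool) = b :: x) {p q : T.N} {c : Bool}
    (hq : (q : List Bool) = c :: p) (hqy : q ≠ y) :
    (T.graph.deleteEdges {s(x, y)}).Adj p q := by
  rw [SimpleGraph.deleteEdges_adj]
  refine ⟨Or.inr ⟨c, hq⟩, fun hmem => ?_⟩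
  rcases Sym2.eq_iff.1 (Set.mem_singleton_iff.1 hmem) with ⟨-, h'⟩ | ⟨rfl, rfl⟩
  · exact hqy h'
  · have h1 := congrArg List.length h
    have h2 := congrArg List.length hq
    simp only [List.length_cons] at h1 h2
    omega

theorem reachable_of_suffix (h : (y : List Bool) = b :: x) (q : T.N)
    (hq : (y : List Bool) <:+ q) : (T.graph.deleteEdges {s(x, y)}).Reachable y q := by
  obtain ⟨q, hqN⟩ := q
  induction q with
  | nil =>
    have := List.suffix_nil.1 hq
    simp [h] at this
  | cons c q ih =>
    by_cases hqy : (⟨c :: q, hqN⟩ : T.N) = y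
    · rw [hqy]
    · have hq' : (y : List Bool) <:+ q :=
        (List.suffix_cons_iff.1 hq).resolve_left fun h' => hqy (Subtype.ext h'.symm)
      exact (ih ((T.cons_mem c q).1 hqN).1 hq').trans (adj_deleteEdges h rfl hqy).reachable

theorem reachable_root (h : (y : List Bool) = b :: x) (q : T.N) (hq : ¬ (y : List Bool) <:+ q) :
    (T.graph.deleteEdges {s(x, y)}).Reachable T.root q := by
  obtain ⟨q, hqN⟩ := q
  induction q with
  | nil => exact .refl _
  | cons c q ih =>
    have hqy : (⟨c :: q, hqN⟩ : T.N) ≠ y := fun h' => hq (h' ▸ List.suffix_rfl)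
    have hq' : ¬ (y : List Bool) <:+ q := fun h' => hq (List.suffix_cons_iff.2 (Or.inr h'))
    exact (ih ((T.cons_mem c q).1 hqN).1 hq').trans (adj_deleteEdges h rfl hqy).reachable

theorem not_suffix (h : (y : List Bool) = b :: x) : ¬ (y : List Bool) <:+ x := fun h' => by
  have := h'.length_le
  simp [h] at this

theorem reachable_child_iff (h : (y : List Bool) = b :: x) (q : T.N) :
    (T.graph.deleteEdges {s(x, y)}).Reachable y q ↔ (y : List Bool) <:+ q :=
  ⟨fun hr => suffix_of_reachable h hr List.suffix_rfl, reachable_of_suffix h q⟩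

theorem reachable_parent_iff (h : (y : List Bool) = b :: x) (q : T.N) :
    (T.graph.deleteEdges {s(x, y)}).Reachable x q ↔ ¬ (y : List Bool) <:+ q :=
  ⟨fun hr hq => not_suffix h (suffix_of_reachable h hr.symm hq),
    fun hq => (reachable_root h x (not_suffix h)).symm.trans (reachable_root h q hq)⟩

end Edge

theorem isTree : T.graph.IsTree where
  connected := by
    have key : ∀ q, T.graph.Reachable T.root q := by
      rintro ⟨q, hq⟩
      induction q with
      | nil => exact .refl _
      | cons c q ih =>
        refine (ih ((T.cons_mem c q).1 hq).1).trans (SimpleGraph.Adj.reachable ?_)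
        exact Or.inr ⟨c, rfl⟩
    have : Nonempty T.N := ⟨T.root⟩
    exact ⟨fun p q => (key p).symm.trans (key q)⟩
  isAcyclic := by
    rw [SimpleGraph.isAcyclic_iff_forall_adj_isBridge]
    rintro x y (⟨b, h⟩ | ⟨b, h⟩)
    · rw [Sym2.eq_swap, SimpleGraph.isBridge_iff]
      exact fun hr => not_suffix h ((reachable_child_iff h _).1 hr.symm)
    · rw [SimpleGraph.isBridge_iff]
      exact fun hr => not_suffix h ((reachable_child_iff h _).1 hr.symm)

variable [Finite V]

/-- The leaf whose set is `{v}`. -/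
noncomputable def leaf (v : V) : treeLeaves T.graph :=
  ⟨(T.exists_leaf v).choose, (T.mem_treeLeaves_iff _).2 (by
    rw [(T.exists_leaf v).choose_spec]
    exact Set.subsingleton_singleton)⟩

theorem A_leaf (v : V) : T.A (T.leaf v : T.N) = {v} := (T.exists_leaf v).choose_spec

theorem leaf_bijective : Function.Bijective T.leaf := by
  constructor
  · intro v w h
    have := T.A_leaf v
    rw [h, T.A_leaf w] at this
    exact (Set.singleton_injective this).symm
  · rintro ⟨y, hy⟩
    have hs := (T.mem_treeLeaves_iff y).1 hy
    obtain ⟨v, hv⟩ := T.nonempty y y.2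
    have hv' : v ∈ T.A (T.leaf v : T.N) := T.A_leaf v ▸ rfl
    refine ⟨v, Subtype.ext (Subtype.ext ?_)⟩
    rcases T.suffix_or_suffix (T.leaf v : T.N).2 y.2 hv' hv with h | h
    · exact T.eq_of_suffix y.2 (T.A_leaf v ▸ Set.subsingleton_singleton) h
    · exact (T.eq_of_suffix (T.leaf v : T.N).2 hs h).symm

theorem suffix_leaf_iff (x : T.N) (v : V) :
    (x : List Bool) <:+ ((T.leaf v : T.N) : List Bool) ↔ v ∈ T.A x := by
  have hv' : v ∈ T.A (T.leaf v : T.N) := T.A_leaf v ▸ rfl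
  constructor
  · exact fun h => T.subset_of_suffix h (T.leaf v : T.N).2 hv'
  · intro h
    rcases T.suffix_or_suffix x.2 (T.leaf v : T.N).2 h hv' with h' | h'
    · exact h'
    · rw [T.eq_of_suffix x.2 (T.A_leaf v ▸ Set.subsingleton_singleton) h']

/-- The branch decomposition given by the tree. -/
noncomputable def branchDecomposition : BranchDecomposition V where
  Node := T.N
  finite_node := T.finite
  tree := T.graph
  isTree := T.isTree
  subcubic := T.encard_neighborSet_le
  leafEquiv := (Equiv.ofBijective T.leaf T.leaf_bijective).symm

theorem side_branchDecomposition {x y : T.N} (h : T.graph.Adj x y) :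
    T.branchDecomposition.side x y = T.A x ∨ T.branchDecomposition.side x y = (T.A y)ᶜ := by
  rcases h with ⟨b, h⟩ | ⟨b, h⟩
  · left
    ext v
    rw [← T.suffix_leaf_iff, ← reachable_child_iff h, Sym2.eq_swap]
    rfl
  · right
    ext v
    rw [Set.mem_compl_iff, ← T.suffix_leaf_iff, ← reachable_parent_iff h]
    rfl

end PartitionTree

namespace Hierarchy

variable {V : Type u} {P : Set V → Prop} {S : Set V}

/-- The hypotheses sit inside the existential so that a total choice of children can be iterated
along lists; elsewhere the children are empty. -/
theorem exists_children (S : Set V) : ∃ c : Bool → Set V, Hierarchy P S → ¬ S.Subsingleton →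
    (∀ b, Hierarchy P (c b)) ∧ (∀ v, v ∈ S ↔ ∃ b, v ∈ c b) ∧
      ∀ v b b', v ∈ c b → v ∈ c b' → b = b' := by
  by_cases h : Hierarchy P S ∧ ¬ S.Subsingleton
  · obtain ⟨h, hs⟩ := h
    cases h with
    | single v => exact absurd Set.subsingleton_singleton hs
    | @union A B hA hB hd _ =>
      refine ⟨fun b => if b then A else B, fun _ _ => ⟨?_, ?_, ?_⟩⟩
      · rintro (_ | _)
        · exact hB
        · exact hA
      · intro v
        simp [or_comm]
      · have := Set.disjoint_left.1 hd
        rintro v (_ | _) (_ | _) h h' <;> simp_all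
  · exact ⟨fun _ => ∅, fun h1 h2 => absurd ⟨h1, h2⟩ h⟩

theorem exists_partitionTree (h : Hierarchy P Set.univ) :
    ∃ T : PartitionTree V, ∀ w ∈ T.N, Hierarchy P (T.A w) := by
  choose c hc using exists_children (P := P)
  let A : List Bool → Set V := fun w => List.rec Set.univ (fun b _ S => c S b) w
  let N : Set (List Bool) :=
    {w | List.rec True (fun _ w p => p ∧ ¬ (A w).Subsingleton) w}
  have hN : ∀ w ∈ N, Hierarchy P (A w) := by
    intro w hw
    induction w with
    | nil => exact h
    | cons b w ih => exact (hc (A w) (ih hw.1) hw.2).1 b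
  exact ⟨{
    N := N
    A := A
    nil_mem := trivial
    nil_eq := rfl
    cons_mem := fun _ _ => Iff.rfl
    nonempty := fun w hw => (hN w hw).nonempty
    mem_iff := fun w hw hs => (hc (A w) (hN w hw) hs).2.1
    eq_of_mem := fun w hw hs => (hc (A w) (hN w hw) hs).2.2 }, hN⟩

theorem exists_branchDecomposition [Finite V] (h : Hierarchy P Set.univ) (hs : ∀ v, P {v}) :
    ∃ D : BranchDecomposition V, ∀ x y, D.tree.Adj x y → P (D.side x y) ∨ P (D.side x y)ᶜ := by
  obtain ⟨T, hT⟩ := h.exists_partitionTree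
  refine ⟨T.branchDecomposition, fun (x y : T.N) hxy => ?_⟩
  rcases T.side_branchDecomposition hxy with h | h
  · rw [h]
    exact Or.inl ((hT x x.2).prop hs)
  · rw [h, compl_compl]
    exact Or.inr ((hT y y.2).prop hs)

end Hierarchy

/-! ### Values of the cut functions -/

section CutFunctions

variable {V : Type u} {G : SimpleGraph V} {A : Set V}

theorem SimpleCut.isSplit (h : SimpleCut G Set.univ A) (h1 : 2 ≤ A.encard) (h2 : 2 ≤ Aᶜ.encard) :
    IsSplit G A := by
  refine ⟨h1, h2, ?_⟩
  rintro a ha b hb ⟨c, hac, hc⟩ ⟨d, hbd, hd⟩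
  ext x
  exact ⟨fun hx => ⟨h hb ha ⟨trivial, hd⟩ ⟨trivial, hx.2⟩ hbd hx.1, hx.2⟩,
    fun hx => ⟨h ha hb ⟨trivial, hc⟩ ⟨trivial, hx.2⟩ hac hx.1, hx.2⟩⟩

theorem matchingCut_compl : matchingCut G Aᶜ = matchingCut G A := by
  rw [matchingCut, matchingCut, compl_compl, SimpleGraph.between_comm]

theorem matchingCut_le_one_of_subsingleton (hA : A.Subsingleton) : matchingCut G A ≤ 1 := by
  refine iSup₂_le fun M hM => Set.encard_le_one_iff.2 ?_
  have key : ∀ e ∈ M.edgeSet, ∃ a ∈ A, ∃ b, e = s(a, b) ∧ M.Adj a b := by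
    intro e
    induction e with
    | _ a b =>
      intro (h : M.Adj a b)
      rcases (M.adj_sub h).2 with ⟨ha, -⟩ | ⟨-, hb⟩
      · exact ⟨a, ha, b, rfl, h⟩
      · exact ⟨b, hb, a, Sym2.eq_swap, h.symm⟩
  intro e f he hf
  obtain ⟨a, ha, b, rfl, hab⟩ := key e he
  obtain ⟨a', ha', b', rfl, hab'⟩ := key f hf
  obtain rfl := hA ha ha'
  rw [hM.eq_of_adj_left hab hab']

/-- A simple cut that is not a split has a side with at most one vertex, and that vertex covers all
crossing edges. -/
theorem SimpleCut.splitMatchingCut_le_one (h : SimpleCut G Set.univ A) :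
    splitMatchingCut G A ≤ 1 := by
  have small : ∀ {B : Set V}, ¬ 2 ≤ B.encard → B.Subsingleton := by
    intro B hB
    rw [← Set.encard_le_one_iff_subsingleton]
    exact Order.le_of_lt_add_one (not_le.1 hB)
  rw [splitMatchingCut]
  split_ifs with hs
  · exact le_rfl
  · by_cases h1 : 2 ≤ A.encard
    · have h2 : ¬ 2 ≤ Aᶜ.encard := fun h2 => hs (h.isSplit h1 h2)
      rw [← matchingCut_compl]
      exact matchingCut_le_one_of_subsingleton (small h2)
    · exact matchingCut_le_one_of_subsingleton (small h1)

theorem one_le_matchingCut {a b : V} (ha : a ∈ A) (hb : b ∉ A) (hab : G.Adj a b) :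
    1 ≤ matchingCut G A := by
  have h : (G.between A Aᶜ).Adj a b := ⟨hab, Or.inl ⟨ha, hb⟩⟩
  refine le_trans ?_ (le_iSup₂_of_le ((G.between A Aᶜ).subgraphOfAdj h)
    (SimpleGraph.Subgraph.IsMatching.subgraphOfAdj h) le_rfl)
  simp

theorem one_le_splitMatchingCut {a b : V} (ha : a ∈ A) (hb : b ∉ A) (hab : G.Adj a b) :
    1 ≤ splitMatchingCut G A := by
  rw [splitMatchingCut]
  split_ifs
  · exact le_rfl
  · exact one_le_matchingCut ha hb hab

theorem one_le_cutRank {a b : V} (ha : a ∈ A) (hb : b ∉ A) (hab : G.Adj a b) :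
    1 ≤ cutRank G A := by
  classical
  rw [cutRank, Matrix.eRank, Order.one_le_iff_pos, pos_iff_ne_zero, ne_eq,
    Cardinal.toENat_eq_zero, Matrix.cRank, Submodule.rank_eq_zero, Submodule.span_eq_bot]
  intro h
  have := congrFun (h _ ⟨⟨b, hb⟩, rfl⟩) ⟨a, ha⟩
  simp [hab] at this

/-- All nonzero columns of the matrix coincide, so a single vector spans the column space. -/
theorem SimpleCut.cutRank_le_one (h : SimpleCut G Set.univ A) : cutRank G A ≤ 1 := by
  classical
  rw [cutRank, Matrix.eRank]
  suffices hsub : ∃ x : A → ZMod 2, Set.range ((G.adjMatrix (ZMod 2)).submatrix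
      (Subtype.val : A → V) (Subtype.val : (Aᶜ : Set V) → V)).col ⊆ {0, x} by
    obtain ⟨x, hx⟩ := hsub
    have hle : Submodule.span (ZMod 2) (Set.range ((G.adjMatrix (ZMod 2)).submatrix
        (Subtype.val : A → V) (Subtype.val : (Aᶜ : Set V) → V)).col) ≤
        Submodule.span (ZMod 2) {x} := by
      refine Submodule.span_le.2 fun y hy => ?_
      rcases hx hy with rfl | rfl
      · exact Submodule.zero_mem _
      · exact Submodule.mem_span_singleton_self _
    have h1 := (Submodule.rank_mono hle).trans (rank_span_le _)
    rw [Cardinal.mk_singleton] at h1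
    exact (Cardinal.toENat.monotone' h1).trans_eq (by simp)
  by_cases hex : ∃ c ∉ A, ∃ a ∈ A, G.Adj a c
  · obtain ⟨c, hc, a, ha, hac⟩ := hex
    refine ⟨fun a => if G.Adj a c then 1 else 0, ?_⟩
    rintro _ ⟨⟨d, hd⟩, rfl⟩
    by_cases hd' : ∃ b ∈ A, G.Adj b d
    · right
      obtain ⟨b, hb, hbd⟩ := hd'
      ext ⟨x, hx⟩
      have : G.Adj x d ↔ G.Adj x c :=
        ⟨fun hxd => h hx ha ⟨trivial, hd⟩ ⟨trivial, hc⟩ hxd hac,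
          fun hxc => h hx hb ⟨trivial, hc⟩ ⟨trivial, hd⟩ hxc hbd⟩
      simp [this, SimpleGraph.adjMatrix_apply]
    · left
      push Not at hd'
      ext ⟨x, hx⟩
      simp [hd' x hx]
  · push Not at hex
    refine ⟨0, ?_⟩
    rintro _ ⟨⟨d, hd⟩, rfl⟩
    left
    ext ⟨x, hx⟩
    simp [hex d hd x hx]

end CutFunctions

/-! ### Bounds on the widths -/

namespace BranchDecomposition

variable {V : Type u} (D : BranchDecomposition V)

theorem width_le_one {f : Set V → ℕ∞} (h : ∀ x y, D.tree.Adj x y → f (D.side x y) ≤ 1) :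
    D.width f ≤ 1 :=
  iSup_le fun x => iSup₂_le fun y hxy => h x y hxy

/-- Each singleton is a side of the cut induced by the edge at its leaf. -/
theorem exists_side_eq_singleton [Nontrivial V] (v : V) :
    ∃ x y, D.tree.Adj x y ∧ D.side x y = {v} := by
  obtain ⟨w, hwv⟩ := exists_ne v
  have hne : ((D.leafEquiv.symm w : treeLeaves D.tree) : D.Node) ≠ D.leafEquiv.symm v :=
    fun h => hwv (D.leafEquiv.symm.injective (Subtype.val_injective h))
  have : Nontrivial D.Node := ⟨_, _, hne⟩
  obtain ⟨y, hxy⟩ := D.isTree.connected.preconnected.exists_adj_of_nontrivial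
    (D.leafEquiv.symm v : D.Node)
  refine ⟨_, y, hxy, ?_⟩
  ext u
  constructor
  · rintro ⟨p⟩
    -- A leaf has only one neighbour, so deleting its edge isolates it.
    have hnil : ∀ {z}, ¬ (D.tree.deleteEdges {s((D.leafEquiv.symm v : D.Node), y)}).Adj
        (D.leafEquiv.symm v) z := by
      intro z hz
      rw [SimpleGraph.deleteEdges_adj] at hz
      obtain rfl := Set.encard_le_one_iff.1 (D.leafEquiv.symm v).2 z y hz.1 hxy
      exact hz.2 rfl
    generalize hq : (D.leafEquiv.symm u : D.Node) = q at p
    cases p with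
    | nil => exact D.leafEquiv.symm.injective (Subtype.val_injective hq)
    | cons h _ => exact absurd h hnil
  · rintro rfl
    exact SimpleGraph.Reachable.refl _

/-- The cut at the leaf of an endpoint `a` of an edge is `{a}`, and that edge crosses it. -/
theorem one_le_width {G : SimpleGraph V} (hG : G ≠ ⊥) {f : Set V → ℕ∞}
    (hf : ∀ A : Set V, ∀ a ∈ A, ∀ b ∉ A, G.Adj a b → 1 ≤ f A) : 1 ≤ D.width f := by
  obtain ⟨a, b, hab⟩ := SimpleGraph.ne_bot_iff_exists_adj.1 hG
  have : Nontrivial V := ⟨a, b, hab.ne⟩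
  obtain ⟨x, y, hxy, hs⟩ := D.exists_side_eq_singleton a
  have h1 := hf (D.side x y) a (hs ▸ rfl) b (hs ▸ hab.ne') hab
  exact h1.trans (le_iSup_of_le x (le_iSup₂_of_le y hxy le_rfl))

end BranchDecomposition

theorem one_le_smWidth {V : Type u} {G : SimpleGraph V} (hG : G ≠ ⊥) : 1 ≤ smWidth G :=
  le_iInf fun D => D.one_le_width hG fun _ _ ha _ hb hab => one_le_splitMatchingCut ha hb hab

namespace Hierarchy

variable {V : Type u} [Finite V] {G : SimpleGraph V}

theorem exists_simple_branchDecomposition (h : Hierarchy (SimpleCut G Set.univ) Set.univ) :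
    ∃ D : BranchDecomposition V, ∀ x y, D.tree.Adj x y → SimpleCut G Set.univ (D.side x y) := by
  obtain ⟨D, hD⟩ := h.exists_branchDecomposition fun v => by
    rintro _ _ c d rfl rfl - - - h
    exact h
  refine ⟨D, fun x y hxy => (hD x y hxy).elim id fun h => ?_⟩
  exact compl_compl (D.side x y) ▸ h.compl

theorem smWidth_le_one (h : Hierarchy (SimpleCut G Set.univ) Set.univ) : smWidth G ≤ 1 := by
  obtain ⟨D, hD⟩ := h.exists_simple_branchDecomposition
  exact (iInf_le _ D).trans (D.width_le_one fun x y hxy => (hD x y hxy).splitMatchingCut_le_one)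

end Hierarchy

theorem mainTheorem8 {V : Type u} [Finite V] [Nonempty V] (G : SimpleGraph V) :
    (IsCograph G ↔ cliqueWidth G ≤ 2) ∧
    (IsCograph G → smWidth G ≤ 1 ∧ (G ≠ ⊥ → smWidth G = 1)) ∧
    (IsDistanceHereditary G →
      cliqueWidth G ≤ 3 ∧
      smWidth G ≤ 1 ∧ (G ≠ ⊥ → smWidth G = 1) ∧
      ∃ D : BranchDecomposition V,
        D.width (cutRank G) ≤ 1 ∧ (G ≠ ⊥ → D.width (cutRank G) = 1) ∧
        ∀ x y, D.tree.Adj x y → 2 ≤ (D.side x y).encard → 2 ≤ (D.side x y)ᶜ.encard →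
          IsSplit G (D.side x y)) := by
  refine ⟨⟨IsCograph.cliqueWidth_le_two, IsCograph.of_cliqueWidth_le_two⟩, fun h => ?_, fun h => ?_⟩
  · have h1 := (h.hierarchy.mono fun _ _ hT => hT.simpleCut).smWidth_le_one
    exact ⟨h1, fun hG => h1.antisymm (one_le_smWidth hG)⟩
  · have h1 := h.hierarchy.smWidth_le_one
    obtain ⟨D, hD⟩ := h.hierarchy.exists_simple_branchDecomposition
    have h2 : D.width (cutRank G) ≤ 1 := D.width_le_one fun x y hxy => (hD x y hxy).cutRank_le_one
    refine ⟨h.cliqueWidth_le_three, h1, fun hG => h1.antisymm (one_le_smWidth hG), D, h2,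
      fun hG => h2.antisymm ?_, fun x y hxy => (hD x y hxy).isSplit⟩
    exact D.one_le_width hG fun _ _ ha _ hb hab => one_le_cutRank ha hb hab
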